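/- Let $\mathcal C$ be an additive category with kernels and cokernels. Let $\mathsf{Ind}(\mathcal C)$ be its category of inductive systems, and let $\overleftarrow{\mathsf{Ind}(\mathcal C)}$ be the category of projective systems $(X_n)_{n\in\mathbb N}$ in $\mathsf{Ind}(\mathcal C)$, with $\mathrm{Hom}(X,Y)=\varprojlim_n\varinjlim_m \mathrm{Hom}(X_m,Y_n)$. An extension (kernel-cokernel pair) $K\to E\to Q$ in $\mathsf{Ind}(\mathcal C)$ is *ind-locally split* if $0\to\mathrm{Hom}(A,K)\to\mathrm{Hom}(A,E)\to\mathrm{Hom}(A,Q)\to 0$ is exact for every object $A$ of $\mathcal C$. The conflations of the *locally split exact structure* on $\overleftarrow{\mathsf{Ind}(\mathcal C)}$ are the extensions isomorphic to a projective system $(K_n\to E_n\to Q_n)_{n\in\mathbb N}$ of ind-locally split extensions. A complex $C$ is *exact* if the diagrams $\ker(d)\to C\to\ker(d)$ (canonical inclusion, and the map induced by $d$) are conflations. Let $C$ be a $\mathbb Z/2$-graded chain complex over $\overleftarrow{\mathsf{Ind}(\mathcal C)}$. Then $C$ can be presented, up to isomorphism of complexes, by a projective system $(C_n)_{n\in\mathbb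 N}$ of $\mathbb Z/2$-graded chain complexes in $\mathsf{Ind}(\mathcal C)$ together with, for each $n$, a small filtered inductive system $(C_{n,i})_{i\in I_n}$ of $\mathbb Z/2$-graded chain complexes in $\mathcal C$ representing $C_n$. For every such presentation the following are equivalent: 1. (*local contractibility*) for every $n$ there is a $k\ge n$ such that for every $i\in I_k$ the composite chain map $C_{k,i}\to C_k\to C_n$ is null-homotopic; 2. $C$ is exact for the locally split exact structure. -/

import Mathlib

open CategoryTheory CategoryTheory.Limits Opposite

universe v u w₁ w₂

noncomputable section

namespace ProInd

/-! ### Ind-objects over an additive category with cokernels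

The category of ind-objects is Mathlib's `Ind C`. Mathlib records its additive structure only for
small `C`; here it is obtained, by the same route, for every locally small `C`. -/

section Ind

variable (C : Type u) [Category.{v} C]

variable {C} in
/-- Ind-objects over a finitely cocomplete category are left exact presheaves. -/
theorem preservesFiniteLimits_of_isIndObject {A : Cᵒᵖ ⥤ Type v} (hA : IsIndObject A) :
    PreservesFiniteLimits A := by
  let P := hA.presentation
  have e : (P.F ⋙ yoneda).flip ⋙ colim ≅ A :=
    (colimitIsoFlipCompColim _).symm ≪≫
      (colimit.isColimit _).coconePointUniqueUpToIso P.isColimit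
  refine ⟨fun J _ _ => ?_⟩
  have : PreservesLimitsOfShape J (P.F ⋙ yoneda).flip :=
    preservesLimitsOfShape_of_evaluation _ _ fun i =>
      inferInstanceAs (PreservesLimitsOfShape J (yoneda.obj (P.F.obj i)))
  exact preservesLimitsOfShape_of_natIso e

/-- The forgetful functor from ind-objects to left exact presheaves. -/
def indToLex : Ind C ⥤ (Cᵒᵖ ⥤ₗ Type v) :=
  ObjectProperty.lift _ (Ind.inclusion C)
    (fun X => preservesFiniteLimits_of_isIndObject (Ind.isIndObject_inclusion_obj X))

/-- This functor is fully faithful. -/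
def indToLexFullyFaithful : (indToLex C).FullyFaithful :=
  Functor.FullyFaithful.ofCompFaithful (G := ObjectProperty.ι _)
    (Ind.inclusion.fullyFaithful (C := C))

attribute [local instance] HasFiniteBiproducts.of_hasFiniteProducts in
/-- The additive structure of `Ind C`; it is unique since `Ind C` has finite biproducts. -/
instance indPreadditive [Preadditive C] [HasFiniteBiproducts C] : Preadditive (Ind C) :=
  .ofFullyFaithful ((indToLexFullyFaithful C).comp
    ((AddCommGrpCat.leftExactFunctorForgetEquivalence _).symm.fullyFaithfulFunctor.comp
      (ObjectProperty.fullyFaithfulι _)))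

end Ind

/-! ### Countable projective systems -/

section Pro

/-- A countable projective system `⋯ ⟶ X 2 ⟶ X 1 ⟶ X 0` in `E`. -/
structure Pro (E : Type w₁) [Category.{w₂} E] where
  /-- The underlying tower. -/
  tower : ℕᵒᵖ ⥤ E

variable {E : Type w₁} [Category.{w₂} E]

namespace Pro

/-- The `n`-th object of a projective system. -/
abbrev obj (X : Pro E) (n : ℕ) : E := X.tower.obj (op n)

/-- The structure map `X m ⟶ X n` for `n ≤ m`. -/
abbrev trans (X : Pro E) {n m : ℕ} (h : n ≤ m) : X.obj m ⟶ X.obj n :=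
  X.tower.map (homOfLE h).op

theorem trans_trans (X : Pro E) {n m k : ℕ} (h : n ≤ m) (h' : m ≤ k) :
    X.trans h' ≫ X.trans h = X.trans (h.trans h') := by
  rw [← Functor.map_comp]; rfl

theorem trans_trans_assoc (X : Pro E) {n m k : ℕ} (h : n ≤ m) (h' : m ≤ k) {T : E}
    (t : X.obj n ⟶ T) : X.trans h' ≫ X.trans h ≫ t = X.trans (h.trans h') ≫ t := by
  rw [← Category.assoc, trans_trans]

theorem trans_self (X : Pro E) (n : ℕ) : X.trans (le_refl n) = 𝟙 _ :=
  X.tower.map_id _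

/-- Two maps `X m ⟶ T` and `X m' ⟶ T` are identified if they agree on some later `X N`. -/
def germSetoid (X : Pro E) (T : E) : Setoid (Σ m : ℕ, X.obj m ⟶ T) where
  r a b := ∃ (N : ℕ) (ha : a.1 ≤ N) (hb : b.1 ≤ N), X.trans ha ≫ a.2 = X.trans hb ≫ b.2
  iseqv :=
    { refl := fun a => ⟨a.1, le_refl _, le_refl _, rfl⟩
      symm := fun ⟨N, ha, hb, h⟩ => ⟨N, hb, ha, h.symm⟩
      trans := by
        rintro a b c ⟨N, ha, hb, h⟩ ⟨N', hb', hc, h'⟩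
        refine ⟨max N N', ha.trans (le_max_left _ _), hc.trans (le_max_right _ _), ?_⟩
        rw [← X.trans_trans_assoc ha (le_max_left N N'), h, X.trans_trans_assoc,
          ← X.trans_trans_assoc hc (le_max_right N N'), ← h', X.trans_trans_assoc] }

/-- The direct limit `colim_m Hom (X m, T)`. -/
def Germ (X : Pro E) (T : E) : Type w₂ := Quotient (X.germSetoid T)

namespace Germ

variable {X : Pro E} {T T' T'' : E}

/-- The class of a map `X m ⟶ T` in `colim_m Hom (X m, T)`. -/
def mk {m : ℕ} (t : X.obj m ⟶ T) : X.Germ T := Quotient.mk (X.germSetoid T) ⟨m, t⟩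

theorem ind {p : X.Germ T → Prop} (h : ∀ (m : ℕ) (t : X.obj m ⟶ T), p (mk t)) (x) : p x :=
  Quotient.ind (fun ⟨m, t⟩ => h m t) x

theorem mk_eq_mk {m m' : ℕ} {t : X.obj m ⟶ T} {t' : X.obj m' ⟶ T} :
    mk t = mk t' ↔
      ∃ (N : ℕ) (h : m ≤ N) (h' : m' ≤ N), X.trans h ≫ t = X.trans h' ≫ t' :=
  Quotient.eq (r := X.germSetoid T)

theorem mk_trans {m k : ℕ} (h : m ≤ k) (t : X.obj m ⟶ T) : mk (X.trans h ≫ t) = mk t :=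
  mk_eq_mk.2 ⟨k, le_refl _, h, by rw [trans_self, Category.id_comp]⟩

/-- Postcomposition `colim_m Hom (X m, T) → colim_m Hom (X m, T')` with a map `T ⟶ T'`. -/
def post (x : X.Germ T) (f : T ⟶ T') : X.Germ T' :=
  Quotient.liftOn x (fun a => mk (a.2 ≫ f)) (by
    rintro ⟨m, t⟩ ⟨m', t'⟩ ⟨N, h, h', e⟩
    exact mk_eq_mk.2 ⟨N, h, h', by
      simpa only [Category.assoc] using congrArg (· ≫ f) e⟩)

@[simp] theorem mk_post {m : ℕ} (t : X.obj m ⟶ T) (f : T ⟶ T') :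
    (mk t).post f = mk (t ≫ f) := rfl

@[simp] theorem post_id (x : X.Germ T) : x.post (𝟙 T) = x := by
  induction x using ind with | h m t => simp

theorem post_post (x : X.Germ T) (f : T ⟶ T') (g : T' ⟶ T'') :
    (x.post f).post g = x.post (f ≫ g) := by
  induction x using ind with | h m t => simp

theorem ind₂ {p : X.Germ T → X.Germ T → Prop}
    (h : ∀ (m : ℕ) (t s : X.obj m ⟶ T), p (mk t) (mk s)) (x y) : p x y := by
  induction x using ind with | h m t =>
  induction y using ind with | h n s =>
  rw [← mk_trans (le_max_left m n) t, ← mk_trans (le_max_right m n) s]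
  exact h _ _ _

end Germ

/-- `Hom (X, Y) = lim_n colim_m Hom (X m, Y n)`. -/
@[ext] structure Hom (X Y : Pro E) where
  /-- The component in `colim_m Hom (X m, Y n)`. -/
  app : ∀ n : ℕ, X.Germ (Y.obj n)
  /-- Compatibility with the structure maps of `Y`. -/
  app_post : ∀ {n m : ℕ} (h : n ≤ m), (app m).post (Y.trans h) = app n

/-- Precomposition of a germ with a morphism of projective systems. -/
def Germ.pre {X Y : Pro E} {T : E} (y : Y.Germ T) (f : Hom X Y) : X.Germ T :=
  Quotient.liftOn y (fun a => (f.app a.1).post a.2) (by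
    rintro ⟨m, t⟩ ⟨m', t'⟩ ⟨N, h, h', e⟩
    dsimp only at h h' e ⊢
    rw [← f.app_post h, ← f.app_post h', Germ.post_post, Germ.post_post, e])

@[simp] theorem Germ.mk_pre {X Y : Pro E} {T : E} {m : ℕ} (t : Y.obj m ⟶ T) (f : Hom X Y) :
    (Germ.mk t).pre f = (f.app m).post t := rfl

theorem Germ.pre_post {X Y : Pro E} {T T' : E} (y : Y.Germ T) (f : Hom X Y) (t : T ⟶ T') :
    (y.pre f).post t = (y.post t).pre f := by
  induction y using Germ.ind with | h m s => simp [Germ.post_post]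

/-- The category of countable projective systems. -/
instance : Category (Pro E) where
  Hom := Hom
  id X :=
    { app := fun n => Germ.mk (𝟙 _)
      app_post := fun {n m} h => by
        rw [Germ.mk_post, Category.id_comp, ← Category.comp_id (X.trans h), Germ.mk_trans] }
  comp f g :=
    { app := fun n => (g.app n).pre f
      app_post := fun h => by rw [Germ.pre_post, g.app_post] }
  id_comp f := by
    ext n
    dsimp only
    induction f.app n using Germ.ind with | h m t => simp
  comp_id f := by
    ext n
    simp
  assoc f g h := by
    ext n
    dsimp only
    induction h.app n using Germ.ind with | h m t => simp [Germ.pre_post]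

@[ext] theorem hom_ext {X Y : Pro E} {f g : X ⟶ Y} (h : ∀ n, Hom.app f n = Hom.app g n) : f = g :=
  Hom.ext (funext h)

theorem comp_app {X Y Z : Pro E} (f : X ⟶ Y) (g : Y ⟶ Z) (n : ℕ) :
    Hom.app (f ≫ g) n = (Hom.app g n).pre f := rfl

theorem id_app (X : Pro E) (n : ℕ) : Hom.app (𝟙 X) n = Germ.mk (𝟙 _) := rfl

variable (E) in
/-- A morphism of towers is a morphism of projective systems. -/
def ofTower : (ℕᵒᵖ ⥤ E) ⥤ Pro E where
  obj F := ⟨F⟩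
  map {F G} φ :=
    { app := fun n => Germ.mk (X := ⟨F⟩) (φ.app (op n))
      app_post := fun {n m} h => by
        rw [Germ.mk_post, ← φ.naturality]
        exact Germ.mk_trans (X := ⟨F⟩) h _ }
  map_comp {F G H} φ ψ := by
    ext n
    rw [comp_app, Germ.mk_pre, Germ.mk_post]
    rfl

@[simp] theorem ofTower_map_app {F G : ℕᵒᵖ ⥤ E} (φ : F ⟶ G) (n : ℕ) :
    Hom.app ((ofTower E).map φ) n = Germ.mk (X := ⟨F⟩) (φ.app (op n)) := rfl

section Preadditive

variable [Preadditive E]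

namespace Germ

variable {X : Pro E} {T T' : E}

instance : Zero (X.Germ T) := ⟨mk (m := 0) 0⟩

instance : Neg (X.Germ T) :=
  ⟨fun x => Quotient.liftOn x (fun a => mk (-a.2)) (by
    rintro ⟨m, t⟩ ⟨m', t'⟩ ⟨N, h, h', e⟩
    exact mk_eq_mk.2 ⟨N, h, h', by simpa using e⟩)⟩

instance : Add (X.Germ T) :=
  ⟨fun x y => Quotient.liftOn₂ x y
    (fun a b => mk (X.trans (le_max_left a.1 b.1) ≫ a.2 + X.trans (le_max_right a.1 b.1) ≫ b.2))
    (by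
      rintro ⟨m, t⟩ ⟨n, s⟩ ⟨m', t'⟩ ⟨n', s'⟩ ⟨N, h, h', e⟩ ⟨M, k, k', e'⟩
      dsimp only at h h' e k k' e' ⊢
      refine mk_eq_mk.2 ⟨max N M, max_le_max h k, max_le_max h' k', ?_⟩
      simp only [Preadditive.comp_add, trans_trans_assoc]
      rw [← X.trans_trans_assoc h (le_max_left N M), e, X.trans_trans_assoc,
        ← X.trans_trans_assoc k (le_max_right N M), e', X.trans_trans_assoc])⟩

theorem zero_def (m : ℕ) : (0 : X.Germ T) = mk (0 : X.obj m ⟶ T) :=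
  mk_eq_mk.2 ⟨m, Nat.zero_le _, le_refl _, by simp⟩

theorem neg_mk {m : ℕ} (t : X.obj m ⟶ T) : -(mk t) = mk (-t) := rfl

theorem mk_add_mk {m : ℕ} (t s : X.obj m ⟶ T) : mk t + mk s = mk (t + s) := by
  change mk _ = _
  rw [← Preadditive.comp_add]
  exact mk_trans _ _

instance : AddCommGroup (X.Germ T) where
  add_assoc x y z := by
    induction x, y using ind₂ with | h m t s =>
    induction z using ind with | h n r =>
    rw [← mk_trans (le_max_left m n) t, ← mk_trans (le_max_left m n) s,
      ← mk_trans (le_max_right m n) r]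
    simp only [mk_add_mk, add_assoc]
  zero_add x := by
    induction x using ind with | h m t => rw [zero_def m, mk_add_mk, zero_add]
  add_zero x := by
    induction x using ind with | h m t => rw [zero_def m, mk_add_mk, add_zero]
  nsmul := nsmulRec
  zsmul := zsmulRec
  neg_add_cancel x := by
    induction x using ind with | h m t => rw [neg_mk, mk_add_mk, neg_add_cancel, zero_def m]
  add_comm x y := by
    induction x, y using ind₂ with | h m t s => rw [mk_add_mk, mk_add_mk, add_comm]

theorem add_post (x y : X.Germ T) (f : T ⟶ T') : (x + y).post f = x.post f + y.post f := by
  induction x, y using ind₂ with | h m t s => simp [mk_add_mk]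

theorem zero_post (f : T ⟶ T') : (0 : X.Germ T).post f = 0 := by
  rw [zero_def 0, mk_post, zero_comp, ← zero_def]

theorem neg_post (x : X.Germ T) (f : T ⟶ T') : (-x).post f = -(x.post f) := by
  induction x using ind with | h m t => simp [neg_mk]

theorem post_add (x : X.Germ T) (f g : T ⟶ T') : x.post (f + g) = x.post f + x.post g := by
  induction x using ind with | h m t => simp [mk_add_mk]

end Germ

variable {X Y : Pro E}

instance : Zero (X ⟶ Y) := ⟨{ app := fun _ => 0, app_post := fun _ => Germ.zero_post _ }⟩

instance : Neg (X ⟶ Y) :=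
  ⟨fun f => { app := fun n => -(Hom.app f n)
              app_post := fun h => by rw [Germ.neg_post, Hom.app_post] }⟩

instance : Add (X ⟶ Y) :=
  ⟨fun f g => { app := fun n => Hom.app f n + Hom.app g n
                app_post := fun h => by rw [Germ.add_post, Hom.app_post, Hom.app_post] }⟩

theorem zero_app (n : ℕ) : Hom.app (0 : X ⟶ Y) n = 0 := rfl

theorem add_app (f g : X ⟶ Y) (n : ℕ) : Hom.app (f + g) n = Hom.app f n + Hom.app g n := rfl

theorem neg_app (f : X ⟶ Y) (n : ℕ) : Hom.app (-f) n = -(Hom.app f n) := rfl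

instance : AddCommGroup (X ⟶ Y) where
  add_assoc f g h := by ext n; simp only [add_app, add_assoc]
  zero_add f := by ext n; simp only [add_app, zero_app, zero_add]
  add_zero f := by ext n; simp only [add_app, zero_app, add_zero]
  nsmul := nsmulRec
  zsmul := zsmulRec
  neg_add_cancel f := by ext n; simp only [add_app, neg_app, zero_app, neg_add_cancel]
  add_comm f g := by ext n; simp only [add_app, add_comm]

instance : Preadditive (Pro E) where
  homGroup X Y := inferInstance
  add_comp X Y Z f g h := by
    ext n
    rw [add_app, comp_app, comp_app, comp_app]
    induction Hom.app h n using Germ.ind with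
    | h m t => simp only [Germ.mk_pre, add_app, Germ.add_post]
  comp_add X Y Z f g h := by
    ext n
    rw [add_app, comp_app, comp_app, comp_app, add_app]
    induction Hom.app g n, Hom.app h n using Germ.ind₂ with
    | h m t s => simp only [Germ.mk_add_mk, Germ.mk_pre, Germ.post_add]

instance : (ofTower E).PreservesZeroMorphisms where
  map_zero F G := by
    ext n
    exact (Germ.zero_def (X := ⟨F⟩) n).symm

end Preadditive

end Pro

end Pro

/-! ### Complexes and extensions -/

section Complexes

/-- `ℤ/2`-graded chain complexes. -/
abbrev Kom (E : Type w₁) [Category.{w₂} E] [HasZeroMorphisms E] :=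
  HomologicalComplex E (ComplexShape.down (ZMod 2))

variable {E : Type w₁} [Category.{w₂} E] [Preadditive E]

/-- The chain complex of projective systems given by a projective system of chain complexes. -/
def komOfTower (L : ℕᵒᵖ ⥤ Kom E) : Kom (Pro E) where
  X i := (Pro.ofTower E).obj (L ⋙ HomologicalComplex.eval E _ i)
  d i j := (Pro.ofTower E).map
    { app := fun n => (L.obj n).d i j
      naturality := fun _ _ f => (L.map f).comm i j }
  shape i j h := by
    refine Eq.trans (congrArg _ ?_) ((Pro.ofTower E).map_zero _ _)
    ext n
    exact (L.obj n).shape i j h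
  d_comp_d' i j k _ _ := by
    refine ((Pro.ofTower E).map_comp _ _).symm.trans
      (Eq.trans (congrArg _ ?_) ((Pro.ofTower E).map_zero _ _))
    ext n
    exact (L.obj n).d_comp_d i j k

/-- The diagram `K ⟶ E ⟶ Q` of projective systems given by a projective system of diagrams
`K n ⟶ E n ⟶ Q n`. -/
def shortComplexOfTower (T : ℕᵒᵖ ⥤ ShortComplex E) : ShortComplex (Pro E) where
  X₁ := (Pro.ofTower E).obj (T ⋙ ShortComplex.π₁)
  X₂ := (Pro.ofTower E).obj (T ⋙ ShortComplex.π₂)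
  X₃ := (Pro.ofTower E).obj (T ⋙ ShortComplex.π₃)
  f := (Pro.ofTower E).map (Functor.whiskerLeft T ShortComplex.π₁Toπ₂)
  g := (Pro.ofTower E).map (Functor.whiskerLeft T ShortComplex.π₂Toπ₃)
  zero := by
    refine ((Pro.ofTower E).map_comp _ _).symm.trans
      (Eq.trans (congrArg _ ?_) ((Pro.ofTower E).map_zero _ _))
    ext n
    exact (T.obj n).zero

/-- An extension: `f` is a kernel of `g` and `g` is a cokernel of `f`. -/
def IsExtension (S : ShortComplex E) : Prop :=
  Nonempty (IsLimit (KernelFork.ofι S.f S.zero)) ∧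
    Nonempty (IsColimit (CokernelCofork.ofπ S.g S.zero))

/-- A chain complex is exact with respect to a class of conflations if `d` has a kernel in each
degree and the diagrams `ker d ⟶ X ⟶ ker d` (canonical inclusion, map induced by `d`) are
conflations. -/
def IsExactComplex (conflation : ShortComplex E → Prop) (X : Kom E) : Prop :=
  ∃ (Z : ZMod 2 → E) (ι : ∀ i, Z i ⟶ X.X i) (p : ∀ i, X.X i ⟶ Z (i - 1))
    (hι : ∀ i, ι i ≫ X.d i (i - 1) = 0)
    (_ : ∀ i, p i ≫ ι (i - 1) = X.d i (i - 1))
    (hp : ∀ i, ι i ≫ p i = 0),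
    (∀ i, Nonempty (IsLimit (KernelFork.ofι (ι i) (hι i)))) ∧
      ∀ i, conflation (ShortComplex.mk (ι i) (p i) (hp i))

end Complexes

section ProInd

variable {C : Type u} [Category.{v} C] [Preadditive C] [HasFiniteBiproducts C]

/-- An extension `K ⟶ E ⟶ Q` in `Ind C` is ind-locally split if `Hom (X, -)` maps it to a short
exact sequence of abelian groups for every object `X` of `C`. -/
def IsIndLocallySplit (S : ShortComplex (Ind C)) : Prop :=
  IsExtension S ∧
    ∀ X : C, (S.map (preadditiveCoyoneda.obj (op (Ind.yoneda.obj X)))).ShortExact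

/-- The conflations of the locally split exact structure on countable projective systems over
`Ind C`: the extensions isomorphic to a projective system of ind-locally split extensions. -/
def IsLocallySplit (S : ShortComplex (Pro (Ind C))) : Prop :=
  IsExtension S ∧
    ∃ T : ℕᵒᵖ ⥤ ShortComplex (Ind C),
      (∀ n, IsIndLocallySplit (T.obj n)) ∧ Nonempty (S ≅ shortComplexOfTower T)

/-- The functor regarding a chain complex in `C` as a chain complex in `Ind C`. -/
abbrev komYoneda : Kom C ⥤ Kom (Ind C) :=
  (Ind.yoneda (C := C)).mapHomologicalComplex _

/-- A presentation of a chain complex `X` of projective systems over `Ind C` by a projective system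
`level 0 ⟵ level 1 ⟵ ⋯` of chain complexes in `Ind C`, each of them written as the inductive system
of a small filtered diagram of chain complexes in `C`. -/
structure Presentation (X : Kom (Pro (Ind C))) where
  /-- The projective system of chain complexes in `Ind C`. -/
  level : ℕᵒᵖ ⥤ Kom (Ind C)
  /-- It represents `X`. -/
  iso : X ≅ komOfTower level
  /-- The index category of the `k`-th inductive system. -/
  I : ℕ → Type v
  [cat : ∀ k, SmallCategory (I k)]
  [filtered : ∀ k, IsFiltered (I k)]
  /-- The `k`-th inductive system of chain complexes in `C`. -/
  diagram : ∀ k, I k ⥤ Kom C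
  /-- The canonical maps to the `k`-th level. -/
  cocone : ∀ k, diagram k ⋙ komYoneda ⟶ (Functor.const (I k)).obj (level.obj (op k))
  /-- The `k`-th level is the inductive system of the diagram. -/
  isColimit : ∀ k, Nonempty (IsColimit (Cocone.mk (level.obj (op k)) (cocone k)))

attribute [instance] Presentation.cat Presentation.filtered

namespace Presentation

variable {X : Kom (Pro (Ind C))} (P : Presentation X)

/-- The component at `i` of the structure map from the `k`-th to the `n`-th level. -/
def component {n k : ℕ} (h : n ≤ k) (i : P.I k) :
    komYoneda.obj ((P.diagram k).obj i) ⟶ P.level.obj (op n) :=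
  (P.cocone k).app i ≫ P.level.map (homOfLE h).op

/-- Local contractibility: for every `n` there is a `k ≥ n` such that the structure map from the
`k`-th to the `n`-th level is null-homotopic on each component of the `k`-th inductive system. -/
def IsLocallyContractible : Prop :=
  ∀ n : ℕ, ∃ (k : ℕ) (h : n ≤ k), ∀ i : P.I k, Nonempty (Homotopy (P.component h i) 0)

end Presentation

end ProInd

end ProInd

end

/-!
Let `L` be a projective system of complexes in `Ind C` presenting `X`. Local contractibility and
exactness are both equivalent to the following lifting property (`IsLocallyExactTower`): every
level `L n` receives a structure map `L k ⟶ L n` that turns each cycle of `L k` defined over an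
object of `C` into a boundary defined over the same object (`LiftsCycles`).

*Local contractibility.* A cycle of `L k` over an object of `C` comes from a complex of the
inductive system for `L k`, where it is a cycle after passing to a later index; so null-homotopies
give lifts (`liftsCycles_of_homotopy`). Conversely, let `K` be a complex of the inductive system.
Since `C` has kernels, the cycles of `K` are objects of `C`, and lifting three times along three
successive cycle lifting structure maps produces a null-homotopy
(`nonempty_homotopy_of_liftsCycles`).

*Exactness.* The levelwise cycles `Z n` form a tower with `Z n ⟶ L n` the kernel of the
differential, and the lifting property says that a map from an object of `C` to `Z (r n)` lifts to
`L n` after composition with `Z (r n) ⟶ Z n`. The pullbacks of `L n ⟶ Z n ⟵ Z (r n)` are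
ind-locally split extensions of `Z (r n)`, and passing to them does not change the projective
system up to isomorphism (`isLocallySplit_map`). That such an extension is a cokernel follows from
the lifting of maps from objects of `C` alone, because these generate `Ind C`
(`exists_desc_of_lift`). Conversely, the lifting property is read off from representatives of an
isomorphism between `ker d ⟶ X ⟶ ker d` and a projective system of ind-locally split extensions
(`isLocallyExactTower_of_isExactComplex`).

*Existence of presentations.* Representatives of the two differentials of `X` can be chosen
inductively so that they are strictly compatible with the structure maps and compose to zero
(`exists_staircase`), but they decrease the level. Gluing a term of degree `0` onto a term of
degree `1` at each level absorbs this shift and gives a projective system of complexes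
(`exists_tower_of_pair`). A complex `D` in `Ind C` is the colimit of all complexes over it with
entries in a small full subcategory of `C` that is closed under finite colimits and generates the
terms of `D` (`exists_kom_presentation`). This index category is filtered because finite colimits
of complexes in `C` exist and are preserved by the passage to `Ind C`.
-/

namespace ProInd

/-! ### Kernels, cokernels and isomorphisms of projective systems -/

section Extensions

variable {E : Type w₁} [Category.{w₂} E] [Preadditive E]

theorem nonempty_isLimit_kernelFork_iff {X Y K : E} {f : X ⟶ Y} {i : K ⟶ X} (w : i ≫ f = 0) :
    Nonempty (IsLimit (KernelFork.ofι i w)) ↔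
      Mono i ∧ ∀ (A : E) (x : A ⟶ X), x ≫ f = 0 → ∃ l : A ⟶ K, l ≫ i = x := by
  constructor
  · rintro ⟨h⟩
    exact ⟨mono_of_isLimit_fork h, fun A x hx => ⟨_, (KernelFork.IsLimit.lift' h x hx).2⟩⟩
  · rintro ⟨hi, h⟩
    exact ⟨KernelFork.IsLimit.ofι' i w fun x hx => ⟨_, (h _ x hx).choose_spec⟩⟩

theorem nonempty_isColimit_cokernelCofork_iff {X Y Q : E} {f : X ⟶ Y} {p : Y ⟶ Q}
    (w : f ≫ p = 0) :
    Nonempty (IsColimit (CokernelCofork.ofπ p w)) ↔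
      Epi p ∧ ∀ (A : E) (x : Y ⟶ A), f ≫ x = 0 → ∃ l : Q ⟶ A, p ≫ l = x := by
  constructor
  · rintro ⟨h⟩
    exact ⟨epi_of_isColimit_cofork h, fun A x hx => ⟨_, (CokernelCofork.IsColimit.desc' h x hx).2⟩⟩
  · rintro ⟨hi, h⟩
    exact ⟨CokernelCofork.IsColimit.ofπ' p w fun x hx => ⟨_, (h _ x hx).choose_spec⟩⟩

theorem isExtension_iff (S : ShortComplex E) :
    IsExtension S ↔
      (Mono S.f ∧ ∀ (A : E) (x : A ⟶ S.X₂), x ≫ S.g = 0 → ∃ l : A ⟶ S.X₁, l ≫ S.f = x) ∧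
      (Epi S.g ∧ ∀ (A : E) (x : S.X₂ ⟶ A), S.f ≫ x = 0 → ∃ l : S.X₃ ⟶ A, S.g ≫ l = x) :=
  and_congr (nonempty_isLimit_kernelFork_iff _) (nonempty_isColimit_cokernelCofork_iff _)

theorem IsExtension.of_iso {S S' : ShortComplex E} (e : S ≅ S') (h : IsExtension S) :
    IsExtension S' := by
  obtain ⟨⟨h₁, h₂⟩, h₃, h₄⟩ := (isExtension_iff S).1 h
  have hf : S'.f = e.inv.τ₁ ≫ S.f ≫ e.hom.τ₂ := by
    rw [← e.hom.comm₁₂, ← ShortComplex.comp_τ₁_assoc]; simp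
  have hg : S'.g = e.inv.τ₂ ≫ S.g ≫ e.hom.τ₃ := by
    rw [← e.hom.comm₂₃, ← ShortComplex.comp_τ₂_assoc]; simp
  refine (isExtension_iff S').2 ⟨⟨?_, fun A x hx => ?_⟩, ?_, fun A x hx => ?_⟩
  · rw [hf]; infer_instance
  · obtain ⟨l, hl⟩ := h₂ _ (x ≫ e.inv.τ₂) (by
      rw [Category.assoc, e.inv.comm₂₃, reassoc_of% hx, zero_comp])
    refine ⟨l ≫ e.hom.τ₁, ?_⟩
    rw [Category.assoc, e.hom.comm₁₂, reassoc_of% hl, ← ShortComplex.comp_τ₂]; simp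
  · rw [hg]; infer_instance
  · obtain ⟨l, hl⟩ := h₄ _ (e.hom.τ₂ ≫ x) (by
      rw [← e.hom.comm₁₂_assoc, hx, comp_zero])
    refine ⟨e.inv.τ₃ ≫ l, ?_⟩
    rw [← e.inv.comm₂₃_assoc, hl, ← ShortComplex.comp_τ₂_assoc]; simp

end Extensions

namespace Pro

variable {E : Type w₁} [Category.{w₂} E]

/-- The `n`-th component of a morphism of towers, between the terms of the projective systems. -/
abbrev level {F G : ℕᵒᵖ ⥤ E} (φ : F ⟶ G) (n : ℕ) :
    ((ofTower E).obj F).obj n ⟶ ((ofTower E).obj G).obj n :=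
  φ.app (op n)

theorem trans_level {F G : ℕᵒᵖ ⥤ E} (φ : F ⟶ G) {n m : ℕ} (h : n ≤ m) :
    ((ofTower E).obj F).trans h ≫ level φ n = level φ m ≫ ((ofTower E).obj G).trans h :=
  φ.naturality _

theorem trans_level_assoc {F G : ℕᵒᵖ ⥤ E} (φ : F ⟶ G) {n m : ℕ} (h : n ≤ m) {T : E}
    (t : ((ofTower E).obj G).obj n ⟶ T) :
    ((ofTower E).obj F).trans h ≫ level φ n ≫ t =
      level φ m ≫ ((ofTower E).obj G).trans h ≫ t := by
  rw [← Category.assoc, trans_level, Category.assoc]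

theorem mk_pre_map {F G : ℕᵒᵖ ⥤ E} (φ : F ⟶ G) {T : E} {m : ℕ}
    (t : ((ofTower E).obj G).obj m ⟶ T) :
    (Germ.mk t).pre ((ofTower E).map φ) = Germ.mk (level φ m ≫ t) := rfl

namespace Germ

variable {X : Pro E} {T T' : E}

theorem exists_rep (y : X.Germ T) : ∃ (m : ℕ) (t : X.obj m ⟶ T), mk t = y := by
  induction y using ind with
  | h m t => exact ⟨m, t, rfl⟩

/-- Representatives of the same germ agree on all sufficiently late terms of the system. -/
theorem eventually_eq {m m' : ℕ} {t : X.obj m ⟶ T} {t' : X.obj m' ⟶ T}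
    (h : mk t = mk t') :
    ∃ M, ∀ N, M ≤ N → ∀ (hm : m ≤ N) (hm' : m' ≤ N), X.trans hm ≫ t = X.trans hm' ≫ t' := by
  obtain ⟨M, h₁, h₂, e⟩ := mk_eq_mk.1 h
  refine ⟨M, fun N hN hm hm' => ?_⟩
  rw [← X.trans_trans_assoc h₁ hN, e, X.trans_trans_assoc]

theorem eventually_zero [Preadditive E] {m : ℕ} {t : X.obj m ⟶ T} (h : mk t = 0) :
    ∃ M, ∀ N, M ≤ N → ∀ hm : m ≤ N, X.trans hm ≫ t = 0 := by
  rw [zero_def m] at h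
  obtain ⟨M, hM⟩ := eventually_eq h
  exact ⟨M, fun N hN hm => by rw [hM N hN hm hm, comp_zero]⟩

theorem post_injective (i : T ⟶ T') [Mono i] :
    Function.Injective fun y : X.Germ T => y.post i := by
  intro y y' h
  induction y, y' using ind₂ with
  | h m t s =>
    obtain ⟨N, h₁, h₂, e⟩ := mk_eq_mk.1 h
    exact mk_eq_mk.2 ⟨N, h₁, h₂, by simpa only [← Category.assoc, cancel_mono] using e⟩

/-- Filtered colimits of abelian groups preserve the left exactness of `Hom (X m, -)`. -/
theorem exists_post_eq [Preadditive E] {K A B : E} {i : K ⟶ A} {f : A ⟶ B}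
    (hi : ∀ (S : E) (x : S ⟶ A), x ≫ f = 0 → ∃ l : S ⟶ K, l ≫ i = x)
    (y : X.Germ A) (hy : y.post f = 0) : ∃ z : X.Germ K, z.post i = y := by
  induction y using ind with
  | h m t =>
    obtain ⟨M, hM⟩ := eventually_zero hy
    obtain ⟨l, hl⟩ := hi _ (X.trans (le_max_right M m) ≫ t) (by
      simpa using hM _ (le_max_left M m) (le_max_right M m))
    exact ⟨mk l, by rw [mk_post, hl, mk_trans]⟩

theorem pre_injective_of_epi {F G : ℕᵒᵖ ⥤ E} (φ : F ⟶ G) (hφ : ∀ n, Epi (level φ n)) :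
    Function.Injective fun y : ((ofTower E).obj G).Germ T => y.pre ((ofTower E).map φ) := by
  intro y y' h
  induction y, y' using ind₂ with
  | h m t s =>
    dsimp only at h
    rw [mk_pre_map, mk_pre_map] at h
    obtain ⟨N, h₁, h₂, e⟩ := mk_eq_mk.1 h
    refine mk_eq_mk.2 ⟨N, h₁, h₂, ?_⟩
    have := hφ N
    rwa [trans_level_assoc, trans_level_assoc, cancel_epi] at e

/-- Filtered colimits of abelian groups preserve the left exactness of `Hom (-, T)`. -/
theorem exists_pre_eq [Preadditive E] {F G H : ℕᵒᵖ ⥤ E} {φ : F ⟶ G} {ψ : G ⟶ H}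
    (hψ : ∀ (n : ℕ) (S : E) (x : ((ofTower E).obj G).obj n ⟶ S), level φ n ≫ x = 0 →
      ∃ l : ((ofTower E).obj H).obj n ⟶ S, level ψ n ≫ l = x)
    (y : ((ofTower E).obj G).Germ T) (hy : y.pre ((ofTower E).map φ) = 0) :
    ∃ z : ((ofTower E).obj H).Germ T, z.pre ((ofTower E).map ψ) = y := by
  induction y using ind with
  | h m t =>
    rw [mk_pre_map] at hy
    obtain ⟨M, hM⟩ := eventually_zero hy
    have h0 := hM _ (le_max_left M m) (le_max_right M m)
    rw [trans_level_assoc] at h0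
    obtain ⟨l, hl⟩ := hψ _ _ _ h0
    exact ⟨mk l, by rw [mk_pre_map, hl, mk_trans]⟩

end Germ

/-- A morphism of projective systems is invertible if precomposition with it is bijective on
germs; surjectivity is only needed for the germs of identity maps. -/
theorem isIso_of_pre {X Y : Pro E} (φ : X ⟶ Y)
    (inj : ∀ T : E, Function.Injective fun y : Y.Germ T => y.pre φ)
    (surj : ∀ n, ∃ y : Y.Germ (X.obj n), y.pre φ = Germ.mk (𝟙 (X.obj n))) : IsIso φ := by
  choose s hs using surj
  let ψ : Y ⟶ X :=
    { app := s
      app_post := fun {n m} h => inj _ (by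
        change ((s m).post _).pre φ = (s n).pre φ
        rw [← Germ.pre_post, hs, hs, Germ.mk_post, Category.id_comp,
          ← Category.comp_id (X.trans h), Germ.mk_trans]) }
  have h₁ : φ ≫ ψ = 𝟙 X := by
    ext n
    exact hs n
  refine ⟨ψ, h₁, ?_⟩
  ext n
  refine inj _ ?_
  change (Hom.app (ψ ≫ φ) n).pre φ = (Germ.mk (𝟙 _)).pre φ
  rw [← comp_app, ← Category.assoc, h₁, Category.id_comp, Germ.mk_pre, Germ.post_id]

/-- A morphism of towers is invertible as a morphism of projective systems if there are maps
backwards, from later terms to earlier ones, that are inverse to it up to structure maps. -/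
theorem isIso_ofTower_map {F G : ℕᵒᵖ ⥤ E} (φ : F ⟶ G)
    (h : ∀ n, ∃ (m : ℕ) (hm : n ≤ m)
      (s : ((ofTower E).obj G).obj m ⟶ ((ofTower E).obj F).obj n),
      s ≫ level φ n = ((ofTower E).obj G).trans hm ∧
        level φ m ≫ s = ((ofTower E).obj F).trans hm) :
    IsIso ((ofTower E).map φ) := by
  refine isIso_of_pre _ (fun T y y' hy => ?_) fun n => ?_
  · induction y, y' using Germ.ind₂ with
    | h m t t' =>
      dsimp only at hy
      rw [mk_pre_map, mk_pre_map] at hy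
      obtain ⟨N, h₁, h₂, e⟩ := Germ.mk_eq_mk.1 hy
      obtain ⟨k, hk, s, hs, -⟩ := h N
      refine Germ.mk_eq_mk.2 ⟨k, h₁.trans hk, h₁.trans hk, ?_⟩
      rw [trans_level_assoc, trans_level_assoc] at e
      rw [← trans_trans_assoc _ h₁ hk, ← trans_trans_assoc _ h₁ hk, ← hs, Category.assoc,
        Category.assoc, e]
  · obtain ⟨m, hm, s, -, hs⟩ := h n
    refine ⟨Germ.mk s, ?_⟩
    rw [mk_pre_map, hs, ← Category.comp_id (trans _ _), Germ.mk_trans]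

section Preadditive

variable [Preadditive E]

/-- Levelwise kernels are kernels of projective systems. -/
theorem ofTower_kernel {F G H : ℕᵒᵖ ⥤ E} {φ : F ⟶ G} {ψ : G ⟶ H}
    (h : ∀ n, Mono (level φ n) ∧
      ∀ (A : E) (x : A ⟶ ((ofTower E).obj G).obj n), x ≫ level ψ n = 0 →
        ∃ l : A ⟶ ((ofTower E).obj F).obj n, l ≫ level φ n = x) :
    Mono ((ofTower E).map φ) ∧ ∀ (A : Pro E) (x : A ⟶ (ofTower E).obj G),
      x ≫ (ofTower E).map ψ = 0 → ∃ l : A ⟶ (ofTower E).obj F, l ≫ (ofTower E).map φ = x := by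
  have := fun n => (h n).1
  constructor
  · refine ⟨fun {A} x y hxy => ?_⟩
    ext n
    exact Germ.post_injective (level φ n) (congrFun (congrArg Hom.app hxy) n)
  · intro A x hx
    have key := fun n => Germ.exists_post_eq (h n).2 (Hom.app x n)
      (congrFun (congrArg Hom.app hx) n)
    choose l hl using key
    refine ⟨⟨l, fun {n m} hnm => Germ.post_injective (level φ n) ?_⟩, ?_⟩
    · change ((l m).post _).post _ = (l n).post _
      rw [hl, Germ.post_post, trans_level, ← Germ.post_post, hl, Hom.app_post]
    · ext n
      exact hl n

/-- Levelwise cokernels are cokernels of projective systems. -/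
theorem ofTower_cokernel {F G H : ℕᵒᵖ ⥤ E} {φ : F ⟶ G} {ψ : G ⟶ H}
    (h : ∀ n, Epi (level ψ n) ∧
      ∀ (A : E) (x : ((ofTower E).obj G).obj n ⟶ A), level φ n ≫ x = 0 →
        ∃ l : ((ofTower E).obj H).obj n ⟶ A, level ψ n ≫ l = x) :
    Epi ((ofTower E).map ψ) ∧ ∀ (A : Pro E) (x : (ofTower E).obj G ⟶ A),
      (ofTower E).map φ ≫ x = 0 → ∃ l : (ofTower E).obj H ⟶ A, (ofTower E).map ψ ≫ l = x := by
  have inj := fun T => Germ.pre_injective_of_epi (T := T) ψ fun n => (h n).1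
  constructor
  · refine ⟨fun {A} x y hxy => ?_⟩
    ext n
    exact inj _ (congrFun (congrArg Hom.app hxy) n)
  · intro A x hx
    have key := fun n => Germ.exists_pre_eq (φ := φ) (ψ := ψ) (fun n => (h n).2) (Hom.app x n)
      (congrFun (congrArg Hom.app hx) n)
    choose l hl using key
    refine ⟨⟨l, fun {n m} hnm => inj _ ?_⟩, ?_⟩
    · change ((l m).post _).pre _ = (l n).pre _
      rw [← Germ.pre_post, hl, hl, Hom.app_post]
    · ext n
      exact hl n

end Preadditive

end Pro

theorem isExtension_shortComplexOfTower {E : Type w₁} [Category.{w₂} E] [Preadditive E]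
    (T : ℕᵒᵖ ⥤ ShortComplex E) (hT : ∀ n, IsExtension (T.obj (op n))) :
    IsExtension (shortComplexOfTower T) :=
  (isExtension_iff _).2
    ⟨Pro.ofTower_kernel (φ := Functor.whiskerLeft T ShortComplex.π₁Toπ₂)
        (ψ := Functor.whiskerLeft T ShortComplex.π₂Toπ₃)
        fun n => ((isExtension_iff _).1 (hT n)).1,
      Pro.ofTower_cokernel (φ := Functor.whiskerLeft T ShortComplex.π₁Toπ₂)
        (ψ := Functor.whiskerLeft T ShortComplex.π₂Toπ₃)
        fun n => ((isExtension_iff _).1 (hT n)).2⟩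

/-! ### Morphisms from objects of `C` to ind-objects -/

section IndObjects

variable {C : Type u} [Category.{v} C]

/-- Morphisms `c ⟶ A` in `Ind C`, for `c` in `C`, are the sections over `c` of the presheaf
underlying `A`. -/
noncomputable def indCoyonedaIso (c : C) :
    coyoneda.obj (op (Ind.yoneda.obj c)) ≅ Ind.inclusion C ⋙ (evaluation _ _).obj (op c) :=
  NatIso.ofComponents
    (fun A => (Ind.inclusion.fullyFaithful.homEquiv.trans
      ((((Ind.yonedaCompInclusion (C := C)).app c).homCongr (Iso.refl _)).trans
        yonedaEquiv)).toIso)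
    (fun {A B} f => by
      ext x
      change yonedaEquiv (_ ≫ (Ind.inclusion C).map (x ≫ f) ≫ 𝟙 _) =
        ((Ind.inclusion C).map f).app (op c)
          (yonedaEquiv (_ ≫ (Ind.inclusion C).map x ≫ 𝟙 _))
      rw [← yonedaEquiv_comp]
      simp)

instance (c : C) (J : Type v) [SmallCategory J] [IsFiltered J] :
    PreservesColimitsOfShape J (coyoneda.obj (op (Ind.yoneda.obj c))) :=
  preservesColimitsOfShape_of_natIso (indCoyonedaIso c).symm

section Filtered

variable {J : Type v} [SmallCategory J] [IsFiltered J] {F : J ⥤ Ind C} {t : Cocone F}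

theorem exists_factor_of_isColimit (ht : IsColimit t) {c : C} (x : Ind.yoneda.obj c ⟶ t.pt) :
    ∃ (j : J) (y : Ind.yoneda.obj c ⟶ F.obj j), y ≫ t.ι.app j = x :=
  Types.jointly_surjective _ (isColimitOfPreserves (coyoneda.obj (op (Ind.yoneda.obj c))) ht) x

theorem eventually_eq_of_isColimit (ht : IsColimit t) {c : C} {j : J}
    (x y : Ind.yoneda.obj c ⟶ F.obj j) (h : x ≫ t.ι.app j = y ≫ t.ι.app j) :
    ∃ (k : J) (f : j ⟶ k), x ≫ F.map f = y ≫ F.map f :=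
  (Types.FilteredColimit.isColimit_eq_iff'
    (isColimitOfPreserves (coyoneda.obj (op (Ind.yoneda.obj c))) ht) x y).1 h

/-- A filtered cocone in `Ind C` is a colimit as soon as morphisms from objects of `C` to its point
factor essentially uniquely through the diagram. -/
theorem nonempty_isColimit_of_factor
    (surj : ∀ (c : C) (x : Ind.yoneda.obj c ⟶ t.pt),
      ∃ (j : J) (y : Ind.yoneda.obj c ⟶ F.obj j), y ≫ t.ι.app j = x)
    (inj : ∀ (c : C) (j : J) (x y : Ind.yoneda.obj c ⟶ F.obj j),
      x ≫ t.ι.app j = y ≫ t.ι.app j → ∃ (k : J) (f : j ⟶ k), x ≫ F.map f = y ≫ F.map f) :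
    Nonempty (IsColimit t) := by
  have key (c : C) :
      Nonempty (IsColimit ((coyoneda.obj (op (Ind.yoneda.obj c))).mapCocone t)) :=
    ⟨Types.FilteredColimit.isColimitOf' _ _
      (fun x => by
        obtain ⟨j, y, h⟩ := surj c x
        exact ⟨j, y, h.symm⟩)
      (fun j x y h => inj c j x y h)⟩
  refine ⟨isColimitOfReflects (Ind.inclusion C) (evaluationJointlyReflectsColimits _ fun c => ?_)⟩
  exact IsColimit.mapCoconeEquiv (indCoyonedaIso c.unop) (key c.unop).some

end Filtered

/-- A choice of a filtered diagram in `C` with a given colimit in `Ind C`. -/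
theorem exists_ind_presentation (A : Ind C) :
    ∃ (J : Type v) (_ : SmallCategory J) (_ : IsFiltered J) (F : J ⥤ C)
      (α : F ⋙ Ind.yoneda ⟶ (Functor.const J).obj A), Nonempty (IsColimit (Cocone.mk A α)) :=
  ⟨A.presentation.I, inferInstance, inferInstance, A.presentation.F,
    (colimit.cocone _).ι ≫ (Functor.const _).map (Ind.colimitPresentationCompYoneda A).hom,
    ⟨(colimit.isColimit _).ofIsoColimit (Cocone.ext (Ind.colimitPresentationCompYoneda A))⟩⟩

theorem ind_hom_ext {A B : Ind C} {f g : A ⟶ B}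
    (h : ∀ (c : C) (x : Ind.yoneda.obj c ⟶ A), x ≫ f = x ≫ g) : f = g := by
  obtain ⟨J, _, _, F, α, ⟨hα⟩⟩ := exists_ind_presentation A
  exact hα.hom_ext fun j => h _ _

/-- A morphism of ind-objects through which every morphism from an object of `C` lifts is a
cokernel of its kernel: a descended morphism is constructed on a presentation of the target from
arbitrary lifts, which are compatible because they are unique up to the kernel. -/
theorem exists_desc_of_lift [Preadditive C] [HasFiniteBiproducts C] {A B T : Ind C} (g : A ⟶ B)
    (hg : ∀ (c : C) (x : Ind.yoneda.obj c ⟶ B), ∃ l : Ind.yoneda.obj c ⟶ A, l ≫ g = x)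
    (t : A ⟶ T) (ht : ∀ (c : C) (x : Ind.yoneda.obj c ⟶ A), x ≫ g = 0 → x ≫ t = 0) :
    ∃ s : B ⟶ T, g ≫ s = t := by
  obtain ⟨J, _, _, F, α, ⟨hα⟩⟩ := exists_ind_presentation B
  choose l hl using fun j => hg (F.obj j) (α.app j)
  have uniq {c : C} {x y : Ind.yoneda.obj c ⟶ A} (h : x ≫ g = y ≫ g) : x ≫ t = y ≫ t := by
    rw [← sub_eq_zero, ← Preadditive.sub_comp]
    exact ht _ _ (by rw [Preadditive.sub_comp, h, sub_self])
  let s : Cocone (F ⋙ Ind.yoneda) := Cocone.mk T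
    { app := fun j => l j ≫ t
      naturality := fun i j f => by
        dsimp only [Functor.const_obj_obj, Functor.const_obj_map]
        rw [Category.comp_id, ← Category.assoc]
        refine uniq ?_
        rw [Category.assoc, hl, hl]
        exact (α.naturality f).trans (Category.comp_id _) }
  refine ⟨hα.desc s, ind_hom_ext fun c x => ?_⟩
  obtain ⟨j, y, hy⟩ := exists_factor_of_isColimit hα (x ≫ g)
  dsimp only at hy
  rw [← Category.assoc, ← hy, Category.assoc, hα.fac s j]
  change y ≫ l j ≫ t = _
  rw [← Category.assoc]
  exact uniq (by rw [Category.assoc, hl, hy])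

variable [Preadditive C] [HasFiniteBiproducts C]

theorem isIndLocallySplit_iff (S : ShortComplex (Ind C)) :
    IsIndLocallySplit S ↔
      (Mono S.f ∧ ∀ (A : Ind C) (x : A ⟶ S.X₂), x ≫ S.g = 0 → ∃ l : A ⟶ S.X₁, l ≫ S.f = x) ∧
      ∀ (c : C) (x : Ind.yoneda.obj c ⟶ S.X₃), ∃ l : Ind.yoneda.obj c ⟶ S.X₂, l ≫ S.g = x := by
  constructor
  · rintro ⟨h₁, h₂⟩
    exact ⟨((isExtension_iff S).1 h₁).1, fun c x => (h₂ c).ab_surjective_g x⟩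
  · rintro ⟨h₁, h₂⟩
    refine ⟨(isExtension_iff S).2 ⟨h₁, ⟨fun {T} x y hxy => ind_hom_ext fun c z => ?_⟩,
      fun T x hx => exists_desc_of_lift _ h₂ _ fun c z hz => ?_⟩, fun c => ?_⟩
    · obtain ⟨l, rfl⟩ := h₂ c z
      rw [Category.assoc, hxy, Category.assoc]
    · obtain ⟨l, rfl⟩ := h₁.2 _ z hz
      rw [Category.assoc, hx, comp_zero]
    · have := h₁.1
      exact
        { exact := (ShortComplex.ab_exact_iff _).2 fun x hx => h₁.2 _ x hx
          mono_f := (AddCommGrpCat.mono_iff_injective _).2 fun x y h => (cancel_mono S.f).1 h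
          epi_g := (AddCommGrpCat.epi_iff_surjective _).2 fun x => h₂ c x }

end IndObjects

/-! ### Lifting cycles and null-homotopies -/

section LiftsCycles

theorem down_rel_sub_one (i : ZMod 2) : (ComplexShape.down (ZMod 2)).Rel i (i - 1) :=
  sub_add_cancel i 1

theorem down_rel_iff {i j : ZMod 2} : (ComplexShape.down (ZMod 2)).Rel i j ↔ j = i - 1 :=
  eq_sub_iff_add_eq.symm

variable {C : Type u} [Category.{v} C] [Preadditive C] [HasFiniteBiproducts C]

/-- A chain map `f : L ⟶ L'` over `Ind C` lifts cycles if the image in `L'` of a cycle of `L`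
defined over an object of `C` is a boundary over that same object. -/
def LiftsCycles {L L' : Kom (Ind C)} (f : L ⟶ L') : Prop :=
  ∀ (i j l : ZMod 2), (ComplexShape.down _).Rel i j → (ComplexShape.down _).Rel j l →
    ∀ (c : C) (z : Ind.yoneda.obj c ⟶ L.X j), z ≫ L.d j l = 0 →
      ∃ w : Ind.yoneda.obj c ⟶ L'.X i, w ≫ L'.d i j = z ≫ f.f j

theorem LiftsCycles.comp_left {L L' L'' : Kom (Ind C)} {f : L' ⟶ L''} (hf : LiftsCycles f)
    (g : L ⟶ L') : LiftsCycles (g ≫ f) := by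
  intro i j l hij hjl c z hz
  obtain ⟨w, hw⟩ := hf i j l hij hjl c (z ≫ g.f j) (by
    rw [Category.assoc, g.comm, reassoc_of% hz, zero_comp])
  exact ⟨w, by rw [hw, Category.assoc, HomologicalComplex.comp_f]⟩

/-- A tower of complexes over `Ind C` is locally exact if every term receives a cycle lifting
structure map. -/
def IsLocallyExactTower (L : ℕᵒᵖ ⥤ Kom (Ind C)) : Prop :=
  ∀ n : ℕ, ∃ (k : ℕ) (h : n ≤ k), LiftsCycles (L.map (homOfLE h).op)

theorem liftsCycles_of_homotopy {L L' : Kom (Ind C)} (f : L ⟶ L') {J : Type v} [SmallCategory J]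
    [IsFiltered J] {D : J ⥤ Kom (Ind C)} {α : D ⟶ (Functor.const J).obj L}
    (hα : IsColimit (Cocone.mk L α)) (h : ∀ j, Nonempty (Homotopy (α.app j ≫ f) 0)) :
    LiftsCycles f := by
  intro i j l hij hjl c z hz
  have hα' (m : ZMod 2) := isColimitOfPreserves (HomologicalComplex.eval (Ind C) _ m) hα
  obtain ⟨s, y, hy⟩ := exists_factor_of_isColimit (hα' j) z
  change Ind.yoneda.obj c ⟶ (D.obj s).X j at y
  change y ≫ (α.app s).f j = z at hy
  -- The cycle condition holds at a later stage of the inductive system.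
  obtain ⟨s', a, ha⟩ := eventually_eq_of_isColimit (hα' l) (y ≫ (D.obj s).d j l) 0 (by
    change (y ≫ (D.obj s).d j l) ≫ (α.app s).f l = 0 ≫ (α.app s).f l
    rw [Category.assoc, ← (α.app s).comm, reassoc_of% hy, zero_comp]
    exact hz)
  change (y ≫ (D.obj s).d j l) ≫ (D.map a).f l = 0 ≫ (D.map a).f l at ha
  rw [Category.assoc, zero_comp, ← (D.map a).comm] at ha
  have hα₂ : D.map a ≫ α.app s' = α.app s := (α.naturality a).trans (Category.comp_id _)
  obtain ⟨H⟩ := h s'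
  have hH := H.comm j
  rw [dNext_eq _ hjl, prevD_eq _ hij, HomologicalComplex.zero_f, add_zero] at hH
  refine ⟨y ≫ (D.map a).f j ≫ H.hom j i, ?_⟩
  have e : H.hom j i ≫ L'.d i j = (α.app s' ≫ f).f j - (D.obj s').d j l ≫ H.hom l j := by
    rw [hH, add_sub_cancel_left]
  rw [Category.assoc, Category.assoc, e, Preadditive.comp_sub, Preadditive.comp_sub,
    reassoc_of% ha, zero_comp, sub_zero, HomologicalComplex.comp_f,
    ← HomologicalComplex.comp_f_assoc, hα₂, ← hy, Category.assoc]

/-- A chain map from a complex in `C` becomes null-homotopic after composition with three cycle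
lifting chain maps. The first lift is defined on the kernels of the differential of the source, the
second one corrects it to a homotopy on the whole complex up to an error that factors through these
kernels, and the third one removes the error. -/
theorem nonempty_homotopy_of_liftsCycles [HasKernels C] {K : Kom C} {L₃ L₂ L₁ L₀ : Kom (Ind C)}
    (φ : komYoneda.obj K ⟶ L₃) {a : L₃ ⟶ L₂} {b : L₂ ⟶ L₁} {c : L₁ ⟶ L₀} (ha : LiftsCycles a)
    (hb : LiftsCycles b) (hc : LiftsCycles c) :
    Nonempty (Homotopy (φ ≫ a ≫ b ≫ c) 0) := by
  let N (j : ZMod 2) : C := kernel (K.d j (j - 1))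
  let ι (j : ZMod 2) : Ind.yoneda.obj (N j) ⟶ (komYoneda.obj K).X j :=
    Ind.yoneda.map (kernel.ι (K.d j (j - 1)))
  let κ (j l : ZMod 2) : (komYoneda.obj K).X j ⟶ Ind.yoneda.obj (N l) :=
    Ind.yoneda.map (kernel.lift _ (K.d j l) (K.d_comp_d _ _ _))
  have κι (j l) : κ j l ≫ ι l = (komYoneda.obj K).d j l := by
    refine (Functor.map_comp _ _ _).symm.trans ?_
    rw [kernel.lift_ι]
    rfl
  have ικ (j l) (h : (ComplexShape.down _).Rel j l) : ι j ≫ κ j l = 0 := by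
    obtain rfl := down_rel_iff.1 h
    refine (Functor.map_comp _ _ _).symm.trans
      ((congrArg _ ?_).trans (Functor.map_zero Ind.yoneda _ _))
    rw [← cancel_mono (kernel.ι _), Category.assoc, kernel.lift_ι, kernel.condition, zero_comp]
  have ιd (j l) (h : (ComplexShape.down _).Rel j l) :
      ι j ≫ (komYoneda.obj K).d j l = 0 := by
    rw [← κι, reassoc_of% (ικ j l h), zero_comp]
  -- On the cycles of `K`, the chain map `φ ≫ a` is a boundary: `σ` lifts it.
  choose σ hσ using fun (i j : ZMod 2) (h : (ComplexShape.down _).Rel i j) =>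
    ha i j (j - 1) h (down_rel_sub_one j) (N j) (ι j ≫ φ.f j) (by
      rw [Category.assoc, φ.comm, ← Category.assoc, ιd j _ (down_rel_sub_one j), zero_comp])
  have hσ' (i j) (h : (ComplexShape.down _).Rel i j) :
      κ i j ≫ σ i j h ≫ L₂.d i j = φ.f i ≫ a.f i ≫ L₂.d i j := by
    rw [hσ, ← Category.assoc, ← Category.assoc, κι, ← φ.comm, Category.assoc, a.comm]
  -- Subtracting `κ ≫ σ` turns `φ ≫ a` into a cycle on all of `K`: `s` lifts it.
  have hs (i j : ZMod 2) (h : (ComplexShape.down _).Rel i j) :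
      ∃ s : (komYoneda.obj K).X j ⟶ L₁.X i, s ≫ L₁.d i j =
        (φ.f j ≫ a.f j - κ j (j - 1) ≫ σ j (j - 1) (down_rel_sub_one j)) ≫ b.f j :=
    hb i j (j - 1) h (down_rel_sub_one j) (K.X j)
      (φ.f j ≫ a.f j - κ j (j - 1) ≫ σ j (j - 1) (down_rel_sub_one j)) (by
      erw [Preadditive.sub_comp, Category.assoc, Category.assoc, hσ', sub_self])
  choose s hs using hs
  have hs' (i j l) (h : (ComplexShape.down _).Rel i j) (h' : (ComplexShape.down _).Rel j l) :
      s i j h ≫ L₁.d i j = (φ.f j ≫ a.f j - κ j l ≫ σ j l h') ≫ b.f j := by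
    obtain rfl := down_rel_iff.1 h'
    exact hs i j h
  -- The choices `σ` and `ι ≫ s` of a lift on cycles differ by a cycle: `τ` lifts the difference.
  choose τ hτ using fun (i j l : ZMod 2) (h : (ComplexShape.down _).Rel i j)
      (h' : (ComplexShape.down _).Rel j l) =>
    hc i j l h h' (N l) (σ j l h' ≫ b.f j - ι l ≫ s j l h') (by
      rw [Preadditive.sub_comp, Category.assoc, Category.assoc,
        hs' j l (l - 1) h' (down_rel_sub_one l), b.comm, ← Category.assoc, hσ,
        Preadditive.sub_comp, Preadditive.comp_sub, Category.assoc, Category.assoc,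
        Category.assoc, Category.assoc, ← Category.assoc (ι l) (κ l _),
        ικ _ _ (down_rel_sub_one l), zero_comp, sub_zero, sub_self])
  refine ⟨(Homotopy.ofEq ?_).trans (Homotopy.nullHomotopy' fun j i h =>
    s i j h ≫ c.f i + κ j (j - 1) ≫ τ i j (j - 1) h (down_rel_sub_one j))⟩
  ext j
  have h : (ComplexShape.down (ZMod 2)).Rel (j + 1) j := rfl
  have h' := down_rel_sub_one j
  rw [Homotopy.nullHomotopicMap'_f h h', Preadditive.add_comp, Category.assoc, Category.assoc,
    hτ, c.comm, ← Category.assoc (s _ _ _), hs' _ _ _ h h', Preadditive.comp_add,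
    ← Category.assoc _ (κ _ _), ← κι j (j - 1), Category.assoc (κ _ _) (ι _) (κ _ _),
    ικ _ _ (down_rel_sub_one _), comp_zero, zero_comp, add_zero]
  simp only [HomologicalComplex.comp_f, Preadditive.sub_comp, Preadditive.comp_sub,
    Category.assoc]
  abel

theorem isLocallyContractible_iff [HasKernels C] {X : Kom (Pro (Ind C))} (P : Presentation X) :
    P.IsLocallyContractible ↔ IsLocallyExactTower P.level := by
  constructor
  · intro h n
    obtain ⟨k, hk, H⟩ := h n
    exact ⟨k, hk, liftsCycles_of_homotopy _ (P.isColimit k).some H⟩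
  · intro h n
    obtain ⟨k₁, h₁, H₁⟩ := h n
    obtain ⟨k₂, h₂, H₂⟩ := h k₁
    obtain ⟨k₃, h₃, H₃⟩ := h k₂
    refine ⟨k₃, h₁.trans (h₂.trans h₃), fun i => ?_⟩
    obtain ⟨H⟩ := nonempty_homotopy_of_liftsCycles ((P.cocone k₃).app i) H₃ H₂ H₁
    refine ⟨(Homotopy.ofEq ?_).trans H⟩
    rw [← Functor.map_comp, ← Functor.map_comp]
    rfl

end LiftsCycles

/-! ### Exactness and lifting of cycles -/

section Exactness

section Tower

theorem IsExactComplex.of_iso {E : Type w₁} [Category.{w₂} E] [Preadditive E]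
    {conflation : ShortComplex E → Prop}
    (hc : ∀ {S S' : ShortComplex E}, (S ≅ S') → conflation S → conflation S') {X Y : Kom E}
    (e : X ≅ Y) (h : IsExactComplex conflation X) : IsExactComplex conflation Y := by
  obtain ⟨Z, ι, p, hι, hd, hp, hk, hc'⟩ := h
  have he₁ (i : ZMod 2) : e.inv.f i ≫ e.hom.f i = 𝟙 _ := by
    rw [← HomologicalComplex.comp_f, e.inv_hom_id, HomologicalComplex.id_f]
  have he₂ (i : ZMod 2) : e.hom.f i ≫ e.inv.f i = 𝟙 _ := by
    rw [← HomologicalComplex.comp_f, e.hom_inv_id, HomologicalComplex.id_f]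
  refine ⟨Z, fun i => ι i ≫ e.hom.f i, fun i => e.inv.f i ≫ p i, fun i => ?_, fun i => ?_,
    fun i => ?_, fun i => ?_, fun i => hc ?_ (hc' i)⟩
  · rw [Category.assoc, e.hom.comm, reassoc_of% (hι i), zero_comp]
  · rw [Category.assoc, reassoc_of% (hd i), ← e.hom.comm, reassoc_of% (he₁ i)]
  · rw [Category.assoc, reassoc_of% (he₂ i), hp]
  · obtain ⟨hm, hl⟩ := (nonempty_isLimit_kernelFork_iff _).1 (hk i)
    refine (nonempty_isLimit_kernelFork_iff _).2 ⟨inferInstance, fun A x hx => ?_⟩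
    obtain ⟨l, hl⟩ := hl A (x ≫ e.inv.f i) (by
      rw [Category.assoc, e.inv.comm, reassoc_of% hx, zero_comp])
    exact ⟨l, by rw [reassoc_of% hl, he₁, Category.comp_id]⟩
  · exact ShortComplex.isoMk (Iso.refl _) ⟨e.hom.f i, e.inv.f i, he₂ i, he₁ i⟩ (Iso.refl _)
      (by simp) (by simp [reassoc_of% (he₂ i)])

variable {E : Type w₁} [Category.{w₂} E] [Preadditive E]

/-- The differential of a tower of complexes, as a morphism of towers. -/
@[simps]
def towerD (L : ℕᵒᵖ ⥤ Kom E) (i j : ZMod 2) :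
    L ⋙ HomologicalComplex.eval E _ i ⟶ L ⋙ HomologicalComplex.eval E _ j where
  app n := (L.obj n).d i j
  naturality _ _ f := (L.map f).comm i j

theorem towerD_comp (L : ℕᵒᵖ ⥤ Kom E) (i j l : ZMod 2) : towerD L i j ≫ towerD L j l = 0 := by
  ext n
  exact (L.obj n).d_comp_d i j l

/-- A short complex of towers, regarded as a tower of short complexes. -/
abbrev towerOfShortComplex (F : ShortComplex (ℕᵒᵖ ⥤ E)) : ℕᵒᵖ ⥤ ShortComplex E :=
  (ShortComplex.functorEquivalence _ _).functor.obj F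

/-- Kernels of morphisms of towers are computed levelwise. -/
theorem kernel_app [HasFiniteLimits E] {F G : ℕᵒᵖ ⥤ E} (φ : F ⟶ G) (n : ℕᵒᵖ) :
    Mono ((kernel.ι φ).app n) ∧ ∀ (A : E) (x : A ⟶ F.obj n), x ≫ φ.app n = 0 →
      ∃ l : A ⟶ (kernel φ).obj n, l ≫ (kernel.ι φ).app n = x :=
  (nonempty_isLimit_kernelFork_iff (by rw [← NatTrans.comp_app, kernel.condition]; rfl)).1
    ⟨isLimitForkMapOfIsLimit' ((evaluation ℕᵒᵖ E).obj n) (kernel.condition φ)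
      (kernelIsKernel φ)⟩

/-- The structure maps `F (r n) ⟶ F n` of a tower, as a morphism from the reindexed tower. -/
@[simps]
def reindexTower (F : ℕᵒᵖ ⥤ E) (r : ℕ → ℕ) (hr : Monotone r) (hr' : ∀ n, n ≤ r n) :
    hr.functor.op ⋙ F ⟶ F where
  app n := F.map (homOfLE (hr' n.unop)).op
  naturality m n f := by
    dsimp
    rw [← F.map_comp, ← F.map_comp]
    rfl

end Tower

variable {C : Type u} [Category.{v} C] [Preadditive C] [HasFiniteBiproducts C]

theorem IsLocallySplit.of_iso {S S' : ShortComplex (Pro (Ind C))} (e : S ≅ S')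
    (h : IsLocallySplit S) : IsLocallySplit S' := by
  obtain ⟨h₁, T, hT, ⟨e'⟩⟩ := h
  exact ⟨h₁.of_iso e, T, hT, ⟨e.symm ≪≫ e'⟩⟩

theorem exists_monotone_liftsCycles {L : ℕᵒᵖ ⥤ Kom (Ind C)} (hL : IsLocallyExactTower L) :
    ∃ (r : ℕ → ℕ) (_ : Monotone r) (h : ∀ n, n ≤ r n),
      ∀ n, LiftsCycles (L.map (homOfLE (h n)).op) := by
  choose k hk H using hL
  have le (n) : k n ≤ (Finset.range (n + 1)).sup k := Finset.le_sup (by simp)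
  refine ⟨fun n => (Finset.range (n + 1)).sup k,
    fun m n h => Finset.sup_mono (Finset.range_mono (by omega)),
    fun n => (hk n).trans (le n), fun n => ?_⟩
  have := (H n).comp_left (L.map (homOfLE (le n)).op)
  rwa [← Functor.map_comp] at this

variable [HasFiniteLimits C]

/-- A tower of left exact sequences `Z n ⟶ F n ⟶ Q n` in `Ind C` in which morphisms from objects
of `C` to `Q (r n)` lift to `F n` is a conflation: pulling back along `Q (r n) ⟶ Q n` turns it
into an isomorphic projective system of ind-locally split extensions. -/
theorem isLocallySplit_map (S : ShortComplex (ℕᵒᵖ ⥤ Ind C))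
    (hS : ∀ n, Mono (S.f.app n) ∧ ∀ (A : Ind C) (x : A ⟶ S.X₂.obj n), x ≫ S.g.app n = 0 →
      ∃ l : A ⟶ S.X₁.obj n, l ≫ S.f.app n = x)
    (r : ℕ → ℕ) (hr : Monotone r) (hr' : ∀ n, n ≤ r n)
    (H : ∀ (n : ℕ) (c : C) (x : Ind.yoneda.obj c ⟶ S.X₃.obj (op (r n))),
      ∃ w : Ind.yoneda.obj c ⟶ S.X₂.obj (op n),
        w ≫ S.g.app (op n) = x ≫ S.X₃.map (homOfLE (hr' n)).op) :
    IsLocallySplit (S.map (Pro.ofTower (Ind C))) := by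
  let θ := reindexTower S.X₃ r hr hr'
  let f' : S.X₁ ⟶ pullback S.g θ := pullback.lift S.f 0 (by simp)
  have hp (n : ℕᵒᵖ) : IsPullback ((pullback.fst S.g θ).app n) ((pullback.snd S.g θ).app n)
      (S.g.app n) (θ.app n) :=
    (IsPullback.of_hasPullback S.g θ).map ((evaluation ℕᵒᵖ (Ind C)).obj n)
  have f'_fst (n : ℕᵒᵖ) : f'.app n ≫ (pullback.fst S.g θ).app n = S.f.app n := by
    rw [← NatTrans.comp_app, pullback.lift_fst]
  have f'_snd (n : ℕᵒᵖ) : f'.app n ≫ (pullback.snd S.g θ).app n = 0 := by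
    rw [← NatTrans.comp_app, pullback.lift_snd]
    rfl
  let S' : ShortComplex (ℕᵒᵖ ⥤ Ind C) :=
    ShortComplex.mk f' (pullback.snd S.g θ) (pullback.lift_snd _ _ _)
  -- The kernel does not change under pullback, and `H` provides the lifts.
  have hT (n : ℕ) : IsIndLocallySplit ((towerOfShortComplex S').obj (op n)) := by
    obtain ⟨hm, hl⟩ := hS (op n)
    change IsIndLocallySplit (ShortComplex.mk (f'.app (op n)) ((pullback.snd S.g θ).app (op n))
      (f'_snd (op n)))
    refine (isIndLocallySplit_iff _).2 ⟨⟨?_, fun A x hx => ?_⟩, fun c x => ?_⟩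
    · rw [← f'_fst] at hm
      exact mono_of_mono _ ((pullback.fst S.g θ).app (op n))
    · dsimp only at x hx ⊢
      obtain ⟨l, hl'⟩ := hl A (x ≫ (pullback.fst S.g θ).app (op n)) (by
        rw [Category.assoc, (hp (op n)).w, reassoc_of% hx, zero_comp])
      refine ⟨l, (hp (op n)).hom_ext ?_ ?_⟩
      · rw [Category.assoc, f'_fst, hl']
      · rw [Category.assoc, f'_snd, comp_zero, hx]
    · obtain ⟨w, hw⟩ := H n c x
      exact ⟨(hp (op n)).lift w x hw, (hp (op n)).lift_snd _ _ _⟩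
  -- The structure map of `S.X₂` and `S.g` define backward maps from later terms to pullbacks.
  have h₂ : IsIso ((Pro.ofTower (Ind C)).map (pullback.fst S.g θ)) := by
    refine Pro.isIso_ofTower_map _ fun n => ⟨r n, hr' n, (hp (op n)).lift
      (S.X₂.map (homOfLE (hr' n)).op) (S.g.app (op (r n))) (S.g.naturality _),
      (hp (op n)).lift_fst _ _ _, ?_⟩
    refine (hp (op n)).hom_ext ?_ ?_
    · refine (Category.assoc _ _ _).trans ((congrArg _ ((hp (op n)).lift_fst _ _ _)).trans ?_)
      exact ((pullback.fst S.g θ).naturality _).symm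
    · refine (Category.assoc _ _ _).trans ((congrArg _ ((hp (op n)).lift_snd _ _ _)).trans ?_)
      exact (hp (op (r n))).w.trans ((pullback.snd S.g θ).naturality _).symm
  have h₃ : IsIso ((Pro.ofTower (Ind C)).map θ) :=
    Pro.isIso_ofTower_map _ fun n => ⟨r n, hr' n, 𝟙 _, Category.id_comp _, Category.comp_id _⟩
  let e : S'.map (Pro.ofTower (Ind C)) ≅ S.map (Pro.ofTower (Ind C)) :=
    ShortComplex.isoMk (Iso.refl _) (@asIso _ _ _ _ _ h₂) (@asIso _ _ _ _ _ h₃)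
      (by
        refine (Category.id_comp _).trans ?_
        refine Eq.trans ?_ ((Pro.ofTower (Ind C)).map_comp _ _)
        rw [pullback.lift_fst]
        rfl)
      (by
        refine ((Pro.ofTower (Ind C)).map_comp _ _).symm.trans ?_
        refine Eq.trans ?_ ((Pro.ofTower (Ind C)).map_comp _ _)
        rw [pullback.condition])
  exact ⟨(isExtension_shortComplexOfTower (towerOfShortComplex S') fun n => (hT n).1).of_iso e,
    towerOfShortComplex S', fun n => hT n.unop, ⟨e.symm⟩⟩

/-- The cycles of a tower of complexes form a tower, through which the differential factors, and
the lifting of cycles is the lifting property that makes the resulting diagrams conflations. -/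
theorem isExactComplex_komOfTower (L : ℕᵒᵖ ⥤ Kom (Ind C)) (hL : IsLocallyExactTower L) :
    IsExactComplex IsLocallySplit (komOfTower L) := by
  obtain ⟨r, hr, hr', H⟩ := exists_monotone_liftsCycles hL
  let Z (i : ZMod 2) : ℕᵒᵖ ⥤ Ind C := kernel (towerD L i (i - 1))
  let ι (i : ZMod 2) : Z i ⟶ L ⋙ HomologicalComplex.eval _ _ i := kernel.ι (towerD L i (i - 1))
  let p (i : ZMod 2) : L ⋙ HomologicalComplex.eval _ _ i ⟶ Z (i - 1) :=
    kernel.lift _ (towerD L i (i - 1)) (towerD_comp _ _ _ _)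
  have pι (i : ZMod 2) : p i ≫ ι (i - 1) = towerD L i (i - 1) := kernel.lift_ι _ _ _
  have ιd (i : ZMod 2) : ι i ≫ towerD L i (i - 1) = 0 := kernel.condition _
  have ιp (i : ZMod 2) : ι i ≫ p i = 0 := by
    rw [← cancel_mono (ι (i - 1)), Category.assoc, pι, ιd, zero_comp]
  have hk (i : ZMod 2) (n : ℕᵒᵖ) := kernel_app (towerD L i (i - 1)) n
  have split (i : ZMod 2) :
      IsLocallySplit ((ShortComplex.mk (ι i) (p i) (ιp i)).map (Pro.ofTower (Ind C))) := by
    refine isLocallySplit_map _ (fun n => ⟨(hk i n).1, fun A x hx => (hk i n).2 A x ?_⟩) r hr hr'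
      fun n c x => ?_
    · rw [← pι, NatTrans.comp_app, reassoc_of% hx, zero_comp]
    · dsimp only at x ⊢
      obtain ⟨w, hw⟩ := H n i (i - 1) (i - 1 - 1) (down_rel_sub_one _) (down_rel_sub_one _) c
        (x ≫ (ι (i - 1)).app (op (r n))) (by
          refine (Category.assoc _ _ _).trans ((congrArg (x ≫ ·) ?_).trans comp_zero)
          exact NatTrans.congr_app (ιd (i - 1)) (op (r n)))
      have := (hk (i - 1) (op n)).1
      refine ⟨w, (cancel_mono ((ι (i - 1)).app (op n))).1 ?_⟩
      refine (Category.assoc _ _ _).trans ((congrArg (w ≫ ·)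
        (NatTrans.congr_app (pι i) (op n))).trans (hw.trans ?_))
      refine (Category.assoc _ _ _).trans (Eq.trans ?_ (Category.assoc _ _ _).symm)
      exact congrArg (x ≫ ·) ((ι (i - 1)).naturality _).symm
  have comp_map {F G K : ℕᵒᵖ ⥤ Ind C} (φ : F ⟶ G) (ψ : G ⟶ K) :
      (Pro.ofTower (Ind C)).map φ ≫ (Pro.ofTower (Ind C)).map ψ =
        (Pro.ofTower (Ind C)).map (φ ≫ ψ) := ((Pro.ofTower (Ind C)).map_comp _ _).symm
  refine ⟨fun i => (Pro.ofTower (Ind C)).obj (Z i), fun i => (Pro.ofTower (Ind C)).map (ι i),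
    fun i => (Pro.ofTower (Ind C)).map (p i), fun i => ?_, fun i => ?_, fun i => ?_, fun i => ?_,
    split⟩
  · exact (comp_map _ _).trans ((congrArg _ (ιd i)).trans (Functor.map_zero _ _ _))
  · exact (comp_map _ _).trans (congrArg _ (pι i))
  · exact (comp_map _ _).trans ((congrArg _ (ιp i)).trans (Functor.map_zero _ _ _))
  · exact (nonempty_isLimit_kernelFork_iff _).2 (Pro.ofTower_kernel fun n => hk i (op n))

/-- A commutative diagram of projective systems can be represented by maps between suitable terms
of the towers. -/
theorem exists_representatives {E : Type w₁} [Category.{w₂} E] {M N F G Z : ℕᵒᵖ ⥤ E} {g : M ⟶ N}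
    {δ : F ⟶ G} {ι : Z ⟶ G} {β : (Pro.ofTower E).obj M ⟶ (Pro.ofTower E).obj F}
    {γ : (Pro.ofTower E).obj N ⟶ (Pro.ofTower E).obj G}
    {lam : (Pro.ofTower E).obj Z ⟶ (Pro.ofTower E).obj N}
    (h₁ : β ≫ (Pro.ofTower E).map δ = (Pro.ofTower E).map g ≫ γ)
    (h₂ : lam ≫ γ = (Pro.ofTower E).map ι) (n : ℕ) :
    ∃ (m k : ℕ) (h : n ≤ k) (b : M.obj (op m) ⟶ F.obj (op n)) (c : N.obj (op m) ⟶ G.obj (op n))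
      (l : Z.obj (op k) ⟶ N.obj (op m)), b ≫ δ.app (op n) = g.app (op m) ≫ c ∧
        l ≫ c = ι.app (op k) ≫ G.map (homOfLE h).op := by
  obtain ⟨m₁, b, hb⟩ := (Pro.Hom.app β n).exists_rep
  obtain ⟨m₂, c, hc⟩ := (Pro.Hom.app γ n).exists_rep
  have e₁ : (Pro.Hom.app β n).post (Pro.level δ n) =
      (Pro.Hom.app γ n).pre ((Pro.ofTower E).map g) := congrFun (congrArg Pro.Hom.app h₁) n
  rw [← hb, ← hc, Pro.Germ.mk_post, Pro.mk_pre_map] at e₁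
  obtain ⟨m, hm₁, hm₂, e₁⟩ := Pro.Germ.mk_eq_mk.1 e₁
  obtain ⟨k₁, l, hl⟩ := (Pro.Hom.app lam m).exists_rep
  have e₂ : (Pro.Hom.app γ n).pre lam = Pro.Germ.mk (Pro.level ι n) :=
    congrFun (congrArg Pro.Hom.app h₂) n
  rw [← hc, ← Pro.Germ.mk_trans hm₂, Pro.Germ.mk_pre, ← hl, Pro.Germ.mk_post] at e₂
  obtain ⟨k, hk₁, hk, e₂⟩ := Pro.Germ.mk_eq_mk.1 e₂
  refine ⟨m, k, hk, ((Pro.ofTower E).obj M).trans hm₁ ≫ b, ((Pro.ofTower E).obj N).trans hm₂ ≫ c,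
    ((Pro.ofTower E).obj Z).trans hk₁ ≫ l, ?_, ?_⟩
  · refine (Category.assoc _ _ _).trans (e₁.trans (Pro.trans_level_assoc g hm₂ c))
  · refine (Category.assoc _ _ _).trans (e₂.trans (Pro.trans_level ι hk))

/-- A cycle `z` of a late level is a section of the projective system of cycles, hence, up to
structure maps, of the cokernel term of a projective system of ind-locally split extensions. There
it lifts, and the image of the lift is the required preimage of `z` under the differential. -/
theorem isLocallyExactTower_of_isExactComplex (L : ℕᵒᵖ ⥤ Kom (Ind C))
    (h : IsExactComplex IsLocallySplit (komOfTower L)) : IsLocallyExactTower L := by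
  obtain ⟨Z, ι, p, hι, hd, hp, hk, hc⟩ := h
  have key (n : ℕ) (i : ZMod 2) : ∃ (k : ℕ) (h : n ≤ k), ∀ (c : C)
      (z : Ind.yoneda.obj c ⟶ (L.obj (op k)).X (i - 1)),
      z ≫ (L.obj (op k)).d (i - 1) (i - 1 - 1) = 0 →
        ∃ w : Ind.yoneda.obj c ⟶ (L.obj (op n)).X i, w ≫ (L.obj (op n)).d i (i - 1) =
          z ≫ (L.map (homOfLE h).op).f (i - 1) := by
    obtain ⟨-, T, hT, ⟨e⟩⟩ := hc i
    let δ := towerD L (i - 1) (i - 1 - 1)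
    obtain ⟨-, hlift⟩ := (nonempty_isLimit_kernelFork_iff _).1 (hk (i - 1))
    obtain ⟨lam, hlam⟩ := hlift _ ((Pro.ofTower (Ind C)).map (kernel.ι δ))
      (((Pro.ofTower (Ind C)).map_comp _ _).symm.trans
        ((congrArg _ (kernel.condition δ)).trans (Functor.map_zero _ _ _)))
    have e₂₃ : e.inv.τ₂ ≫ p i = (shortComplexOfTower T).g ≫ e.inv.τ₃ := e.inv.comm₂₃
    have e₃ : e.hom.τ₃ ≫ e.inv.τ₃ = 𝟙 (Z (i - 1)) := by
      rw [← ShortComplex.comp_τ₃, e.hom_inv_id]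
      rfl
    obtain ⟨m, k, hnk, b, q, l, hb, hl⟩ := exists_representatives
      (g := Functor.whiskerLeft T ShortComplex.π₂Toπ₃) (δ := towerD L i (i - 1))
      (ι := kernel.ι δ) (β := e.inv.τ₂) (γ := e.inv.τ₃ ≫ ι (i - 1)) (lam := lam ≫ e.hom.τ₃)
      ((congrArg _ (hd i).symm).trans (by
        refine (Category.assoc _ _ _).symm.trans ((congrArg (· ≫ ι (i - 1)) e₂₃).trans ?_)
        exact Category.assoc _ _ _))
      (by
        refine (Category.assoc _ _ _).trans (Eq.trans (congrArg (lam ≫ ·) ?_) hlam)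
        exact (Category.assoc _ _ _).symm.trans
          ((congrArg (· ≫ ι (i - 1)) e₃).trans (Category.id_comp _))) n
    refine ⟨k, hnk, fun c z hz => ?_⟩
    obtain ⟨z', hz'⟩ := (kernel_app δ (op k)).2 _ z hz
    obtain ⟨w, hw⟩ := ((isIndLocallySplit_iff _).1 (hT (op m))).2 c (z' ≫ l)
    refine ⟨w ≫ b, ?_⟩
    refine (Category.assoc _ _ _).trans ((congrArg (w ≫ ·) hb).trans ?_)
    refine (Category.assoc _ _ _).symm.trans ((congrArg (· ≫ q) hw).trans ?_)
    refine (Category.assoc _ _ _).trans ((congrArg (z' ≫ ·) hl).trans ?_)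
    exact (Category.assoc _ _ _).symm.trans (congrArg (· ≫ (L.map (homOfLE hnk).op).f (i - 1)) hz')
  intro n
  choose k hnk H using key n
  have hle (i : ZMod 2) : k i ≤ Finset.univ.sup k := Finset.le_sup (Finset.mem_univ i)
  refine ⟨Finset.univ.sup k, (hnk 0).trans (hle 0), fun i j l hij hjl c z hz => ?_⟩
  obtain rfl := down_rel_iff.1 hij
  obtain rfl := down_rel_iff.1 hjl
  obtain ⟨w, hw⟩ := H i c (z ≫ (L.map (homOfLE (hle i)).op).f (i - 1)) (by
    rw [Category.assoc, HomologicalComplex.Hom.comm, reassoc_of% hz, zero_comp])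
  refine ⟨w, hw.trans ?_⟩
  rw [Category.assoc, ← HomologicalComplex.comp_f, ← L.map_comp]
  rfl

theorem isLocallyContractible_iff_isExactComplex {X : Kom (Pro (Ind C))}
    (P : Presentation X) :
    P.IsLocallyContractible ↔ IsExactComplex IsLocallySplit X :=
  (isLocallyContractible_iff P).trans
    ⟨fun h => (isExactComplex_komOfTower _ h).of_iso IsLocallySplit.of_iso P.iso.symm,
      fun h => isLocallyExactTower_of_isExactComplex _ (h.of_iso IsLocallySplit.of_iso P.iso)⟩

end Exactness

/-! ### Complexes of ind-objects as inductive systems of complexes -/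

section Free

/-- The `ℤ/2`-graded complex freely generated by an object in degree `i`. -/
def freeKom {E : Type w₁} [Category.{w₂} E] [Preadditive E] (i : ZMod 2) (A : E) : Kom E where
  X _ := A
  d k l := if k = i ∧ l = i - 1 then 𝟙 A else 0
  shape k l h := if_neg (by
    rintro ⟨rfl, rfl⟩
    exact h (down_rel_sub_one _))
  d_comp_d' k l m _ _ := by
    by_cases h : k = i ∧ l = i - 1
    · have h' : l ≠ i := fun h'' => by
        have hi : ∀ i : ZMod 2, i - 1 ≠ i := by decide
        exact hi i (h.2.symm.trans h'')
      rw [if_neg (c := l = i ∧ m = i - 1) fun h'' => h' h''.1, comp_zero]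
    · rw [if_neg h, zero_comp]

variable {M : Type w₁} [Category.{w₂} M] [Preadditive M] {E : Type u} [Category.{v} E]
  [Preadditive E] (H : M ⥤ E) [H.PreservesZeroMorphisms] {i : ZMod 2} {A : M} {D : Kom E}

theorem map_freeKom_d (k l : ZMod 2) :
    ((H.mapHomologicalComplex _).obj (freeKom i A)).d k l =
      if k = i ∧ l = i - 1 then 𝟙 (H.obj A) else 0 := by
  change H.map (if k = i ∧ l = i - 1 then 𝟙 A else 0) = _
  split_ifs <;> simp

/-- The chain map on the free complex induced by a morphism in degree `i`. -/
def freeKomDesc (φ : H.obj A ⟶ D.X i) :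
    (H.mapHomologicalComplex _).obj (freeKom i A) ⟶ D where
  f k := if h : k = i then φ ≫ eqToHom (by rw [h]) else φ ≫ D.d i k
  comm' k l hkl := by
    rw [map_freeKom_d]
    obtain rfl := down_rel_iff.1 hkl
    have hi : ∀ i : ZMod 2, i - 1 ≠ i := by decide
    by_cases h : k = i
    · subst h
      rw [dif_pos rfl, dif_neg (hi k), if_pos ⟨rfl, rfl⟩]
      exact (congrArg (· ≫ D.d k (k - 1)) (Category.comp_id φ)).trans (Category.id_comp _).symm
    · rw [dif_neg h, if_neg fun h' => h h'.1]
      exact (Category.assoc _ _ _).trans ((congrArg (φ ≫ ·) (D.d_comp_d _ _ _)).trans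
        (comp_zero.trans zero_comp.symm))

theorem freeKomDesc_f (φ : H.obj A ⟶ D.X i) : (freeKomDesc H φ).f i = φ :=
  (dif_pos rfl).trans (Category.comp_id φ)

variable {H} in
theorem freeKom_hom_ext {f g : (H.mapHomologicalComplex _).obj (freeKom i A) ⟶ D}
    (h : f.f i = g.f i) : f = g := by
  ext k
  have hi : ∀ k i : ZMod 2, k ≠ i → k = i - 1 := by decide
  by_cases hk : k = i
  · subst hk
    exact h
  · obtain rfl := hi k i hk
    have hd (f : (H.mapHomologicalComplex _).obj (freeKom i A) ⟶ D) :
        f.f (i - 1) = f.f i ≫ D.d i (i - 1) := by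
      rw [f.comm, map_freeKom_d, if_pos ⟨rfl, rfl⟩]
      exact (Category.id_comp _).symm
    rw [hd, hd, h]

end Free

section Small

variable {C : Type u} [Category.{v} C] [Preadditive C]

/-- A small family of objects lies in a small full subcategory closed under finite colimits. -/
theorem exists_small_subcategory [HasFiniteColimits C] {I : Type v} (a : I → C) :
    ∃ (M : Type v) (_ : SmallCategory M) (_ : Preadditive M) (_ : HasFiniteColimits M)
      (F : M ⥤ C) (_ : F.Additive) (_ : F.Full) (_ : F.Faithful) (_ : PreservesFiniteColimits F),
      ∀ k, ∃ m, Nonempty (F.obj m ≅ a k) := by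
  let P : ObjectProperty C := (ObjectProperty.ofObj a).colimitsCardinalClosure Cardinal.aleph0.{v}
  have hP (J : Type) [SmallCategory J] [FinCategory J] : P.IsClosedUnderColimitsOfShape J :=
    ObjectProperty.isClosedUnderColimitsOfShape_colimitsCardinalClosure _ _ J (by
      rw [hasCardinalLT_aleph0_iff]
      infer_instance)
  have : HasFiniteColimits P.FullSubcategory := ⟨fun J _ _ =>
    hasColimitsOfShape_of_hasColimitsOfShape_createsColimitsOfShape P.ι⟩
  have : PreservesFiniteColimits P.ι := ⟨fun J _ _ => inferInstance⟩
  let e := equivSmallModel.{v} P.FullSubcategory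
  have : HasFiniteColimits (SmallModel.{v} P.FullSubcategory) := ⟨fun J _ _ =>
    Adjunction.hasColimitsOfShape_of_equivalence e.inverse⟩
  let F : SmallModel.{v} P.FullSubcategory ⥤ C := e.inverse ⋙ P.ι
  let hF : F.FullyFaithful := e.fullyFaithfulInverse.comp P.fullyFaithfulι
  let _ : Preadditive (SmallModel.{v} P.FullSubcategory) := .ofFullyFaithful hF
  refine ⟨SmallModel.{v} P.FullSubcategory, inferInstance, inferInstance, inferInstance, F,
    hF.additive_ofFullyFaithful, hF.full, hF.faithful, comp_preservesFiniteColimits _ _,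
    fun k => ?_⟩
  let x : P.FullSubcategory := ⟨a k, ObjectProperty.le_colimitsCardinalClosure _ _ _ ⟨k⟩⟩
  exact ⟨e.functor.obj x, ⟨P.ι.mapIso (e.unitIso.symm.app x)⟩⟩

/-- A small family of ind-objects is generated by a small full subcategory closed under finite
colimits: morphisms from objects of `C` factor through it, essentially uniquely. -/
theorem exists_generating_subcategory [HasFiniteBiproducts C] [HasFiniteColimits C] {ι : Type v}
    (X : ι → Ind C) :
    ∃ (M : Type v) (_ : SmallCategory M) (_ : Preadditive M) (_ : HasFiniteColimits M)
      (F : M ⥤ C) (_ : F.Additive) (_ : PreservesFiniteColimits F),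
      ∀ i, (∀ (c : C) (x : Ind.yoneda.obj c ⟶ X i),
        ∃ (m : M) (y : Ind.yoneda.obj c ⟶ (F ⋙ Ind.yoneda).obj m)
          (φ : (F ⋙ Ind.yoneda).obj m ⟶ X i), y ≫ φ = x) ∧
        ∀ (k : M) (κ : (F ⋙ Ind.yoneda).obj k ⟶ X i) (c : C)
          (x y : Ind.yoneda.obj c ⟶ (F ⋙ Ind.yoneda).obj k), x ≫ κ = y ≫ κ →
          ∃ (m : M) (f : k ⟶ m) (φ : (F ⋙ Ind.yoneda).obj m ⟶ X i),
            (F ⋙ Ind.yoneda).map f ≫ φ = κ ∧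
              x ≫ (F ⋙ Ind.yoneda).map f = y ≫ (F ⋙ Ind.yoneda).map f := by
  choose I hI₁ hI₂ a β hβ using fun i => exists_ind_presentation (X i)
  obtain ⟨M, _, _, _, F, _, _, _, _, hM⟩ :=
    exists_small_subcategory fun k : Σ i, I i => (a k.1).obj k.2
  have hM (i : ι) (k : I i) : ∃ m, Nonempty (F.obj m ≅ (a i).obj k) := hM ⟨i, k⟩
  have he {A B : C} (e : A ≅ B) : Ind.yoneda.map e.inv ≫ Ind.yoneda.map e.hom = 𝟙 _ := by
    rw [← Functor.map_comp, e.inv_hom_id, CategoryTheory.Functor.map_id]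
  refine ⟨M, inferInstance, inferInstance, inferInstance, F, inferInstance, inferInstance,
    fun i => ⟨fun c x => ?_, fun k κ c x y hxy => ?_⟩⟩
  · obtain ⟨k, y, hy⟩ := exists_factor_of_isColimit (hβ i).some x
    obtain ⟨m, ⟨e⟩⟩ := hM i k
    refine ⟨m, y ≫ Ind.yoneda.map e.inv, Ind.yoneda.map e.hom ≫ (β i).app k, ?_⟩
    rw [Category.assoc, reassoc_of% (he e)]
    exact hy
  · dsimp only [Functor.comp_obj, Functor.comp_map] at κ x y hxy ⊢
    obtain ⟨j, w, hw⟩ := exists_factor_of_isColimit (hβ i).some κ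
    dsimp only [Functor.comp_obj] at w hw
    obtain ⟨j', f, hf⟩ := eventually_eq_of_isColimit (hβ i).some (x ≫ w) (y ≫ w) (by
      rw [← hw, ← Category.assoc, ← Category.assoc] at hxy
      exact hxy)
    dsimp only [Functor.comp_map] at hf
    have hβf : Ind.yoneda.map ((a i).map f) ≫ (β i).app j' = (β i).app j :=
      ((β i).naturality f).trans (Category.comp_id _)
    obtain ⟨m, ⟨e⟩⟩ := hM i j'
    have hv := F.map_preimage (Ind.yoneda.preimage
      (w ≫ Ind.yoneda.map ((a i).map f) ≫ Ind.yoneda.map e.inv))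
    refine ⟨m, F.preimage (Ind.yoneda.preimage
      (w ≫ Ind.yoneda.map ((a i).map f) ≫ Ind.yoneda.map e.inv)),
      Ind.yoneda.map e.hom ≫ (β i).app j', ?_, ?_⟩
    · rw [hv, Ind.yoneda.map_preimage, Category.assoc, Category.assoc, reassoc_of% (he e), hβf,
        hw]
    · rw [hv, Ind.yoneda.map_preimage, ← Category.assoc, ← Category.assoc, ← Category.assoc,
        ← Category.assoc, hf]

/-- Every complex in `Ind C` is the inductive system of a small filtered diagram of complexes
in `C`, namely of all complexes over it with entries in a suitable small subcategory of `C`.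
The colimit is computed degreewise, and free complexes reduce the comparison to morphisms into a
single degree. -/
theorem exists_kom_presentation [HasFiniteBiproducts C] [HasFiniteColimits C] (D : Kom (Ind C)) :
    ∃ (J : Type v) (_ : SmallCategory J) (_ : IsFiltered J) (K : J ⥤ Kom C)
      (α : K ⋙ komYoneda ⟶ (Functor.const J).obj D), Nonempty (IsColimit (Cocone.mk D α)) := by
  obtain ⟨M, _, _, _, F, _, _, hM⟩ :=
    exists_generating_subcategory fun i : ULift.{v} (ZMod 2) => D.X i.down
  let H : M ⥤ Ind C := F ⋙ Ind.yoneda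
  let G : Kom M ⥤ Kom (Ind C) := H.mapHomologicalComplex _
  have : PreservesFiniteColimits G := ⟨fun J _ _ =>
    HomologicalComplex.preservesColimitsOfShape_of_eval G fun i =>
      inferInstanceAs (PreservesColimitsOfShape J (HomologicalComplex.eval M _ i ⋙ H))⟩
  have : RepresentablyCoflat G := coflat_of_preservesFiniteColimits G
  let J := CostructuredArrow G D
  have : IsFiltered J := RepresentablyCoflat.filtered D
  let K : J ⥤ Kom C := CostructuredArrow.proj G D ⋙ F.mapHomologicalComplex _
  let α : K ⋙ komYoneda ⟶ (Functor.const J).obj D :=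
    { app := fun j => j.hom
      naturality := fun j j' f => (CostructuredArrow.w f).trans (Category.comp_id _).symm }
  refine ⟨J, inferInstance, inferInstance, K, α,
    ⟨HomologicalComplex.isColimitOfEval _ _ fun i => Nonempty.some ?_⟩⟩
  refine nonempty_isColimit_of_factor (fun c x => ?_) fun c j x y hxy => ?_
  · obtain ⟨m, y, φ, h⟩ := (hM ⟨i⟩).1 c x
    exact ⟨CostructuredArrow.mk (Y := freeKom i m) (f := freeKomDesc H φ), y,
      (congrArg (y ≫ ·) (freeKomDesc_f H φ)).trans h⟩
  · let κ : H.obj (j.left.X i) ⟶ D.X i := j.hom.f i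
    obtain ⟨m, v, φ, hvφ, hxyv⟩ := (hM ⟨i⟩).2 (j.left.X i) κ c x y hxy
    -- Gluing the free complex on `m` to `j.left` identifies `x` and `y` in a complex over `D`.
    let A : J := CostructuredArrow.mk (Y := freeKom i (j.left.X i)) (f := freeKomDesc H κ)
    let B : J := CostructuredArrow.mk (Y := freeKom i m) (f := freeKomDesc H φ)
    let q₁ : freeKom i (j.left.X i) ⟶ j.left := freeKomDesc (𝟭 M) (𝟙 _)
    have hq₁ : q₁.f i = 𝟙 _ := freeKomDesc_f (𝟭 M) _
    let q₂ : freeKom i (j.left.X i) ⟶ freeKom i m := freeKomDesc (𝟭 M) v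
    have hq₂ : q₂.f i = v := freeKomDesc_f (𝟭 M) _
    let Q₁ : A ⟶ j := CostructuredArrow.homMk q₁ (freeKom_hom_ext (i := i) (by
      refine Eq.trans ?_ (freeKomDesc_f H κ).symm
      refine Eq.trans (congrArg (· ≫ κ) ((congrArg H.map hq₁).trans (H.map_id _))) ?_
      exact Category.id_comp _))
    let Q₂ : A ⟶ B := CostructuredArrow.homMk q₂ (freeKom_hom_ext (i := i) (by
      refine Eq.trans ?_ (freeKomDesc_f H κ).symm
      refine Eq.trans (congrArg₂ (· ≫ ·) (congrArg H.map hq₂) (freeKomDesc_f H φ)) ?_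
      exact hvφ))
    obtain ⟨l, g₁, g₂, hg⟩ := IsFiltered.span Q₁ Q₂
    have hg' : g₁.left.f i = v ≫ g₂.left.f i := by
      have : q₁.f i ≫ g₁.left.f i = q₂.f i ≫ g₂.left.f i :=
        congrArg (fun t => t.left.f i) hg
      rw [hq₂, hq₁] at this
      exact (Category.id_comp _).symm.trans this
    refine ⟨l, g₁, ?_⟩
    change x ≫ H.map (g₁.left.f i) = y ≫ H.map (g₁.left.f i)
    have hg'' := (congrArg H.map hg').trans (H.map_comp _ _)
    refine (congrArg (x ≫ ·) hg'').trans (Eq.trans ?_ (congrArg (y ≫ ·) hg'').symm)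
    exact (Category.assoc _ _ _).symm.trans
      ((congrArg (· ≫ H.map (g₂.left.f i)) hxyv).trans (Category.assoc _ _ _))

end Small

/-! ### Complexes of projective systems as projective systems of complexes -/

section Straighten

variable {E : Type w₁} [Category.{w₂} E]

/-- Interleaved projective systems are isomorphic: maps `x n : X (c n) ⟶ Y n` and
`s n : Y n ⟶ X (e n)` whose composites in both orders are structure maps represent inverse
isomorphisms. -/
theorem Pro.exists_iso_of_interleaving {X Y : Pro E} (c e : ℕ → ℕ) (hn : ∀ n, n ≤ e n)
    (hec : ∀ n, e n ≤ c n) (hce : ∀ n, c n ≤ e (n + 1)) (x : ∀ n, X.obj (c n) ⟶ Y.obj n)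
    (s : ∀ n, Y.obj n ⟶ X.obj (e n)) (hxs : ∀ n, x n ≫ s n = X.trans (hec n))
    (hsx : ∀ n, s (n + 1) ≫ X.trans (hce n) ≫ x n = Y.trans n.le_succ) :
    ∃ φ : X ≅ Y, ∀ n, Hom.app φ.hom n = Germ.mk (x n) := by
  -- The hypothesis `hsx`, iterated to structure maps of arbitrary length.
  have hY (n k : ℕ) (h : n < k) :
      ∃ h' : c n ≤ e k, s k ≫ X.trans h' ≫ x n = Y.trans h.le := by
    induction k, h using Nat.le_induction with
    | base => exact ⟨hce n, hsx n⟩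
    | succ k hk ih =>
      obtain ⟨h', ih⟩ := ih
      refine ⟨h'.trans ((hec k).trans (hce k)), ?_⟩
      rw [← Y.trans_trans (Nat.le_of_succ_le hk) k.le_succ, ← ih, ← hsx k, Category.assoc,
        Category.assoc, reassoc_of% (hxs k), X.trans_trans_assoc, X.trans_trans_assoc]
  let φ : X ⟶ Y :=
    { app := fun n => Germ.mk (x n)
      app_post := fun {n m} h => by
        rcases h.eq_or_lt with rfl | h
        · rw [trans_self, Germ.post_id]
        · obtain ⟨h', e⟩ := hY n m h
          rw [← e, Germ.mk_post, reassoc_of% (hxs m), X.trans_trans_assoc, Germ.mk_trans] }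
  have : IsIso φ := by
    refine isIso_of_pre φ (fun T y y' h => ?_) fun n => ⟨Germ.mk (s n ≫ X.trans (hn n)), ?_⟩
    · induction y, y' using Germ.ind₂ with
      | h n t t' =>
        have h' : Germ.mk (x n ≫ t) = Germ.mk (x n ≫ t') := h
        obtain ⟨M, h₁, h₂, h'⟩ := Germ.mk_eq_mk.1 h'
        have hK : n < max M (n + 1) := lt_max_of_lt_right n.lt_succ_self
        obtain ⟨h₃, hY⟩ := hY n _ hK
        refine Germ.mk_eq_mk.2 ⟨_, hK.le, hK.le, ?_⟩
        have h₄ : M ≤ e (max M (n + 1)) := (le_max_left _ _).trans (hn _)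
        rw [← hY, Category.assoc, Category.assoc, Category.assoc, Category.assoc,
          ← X.trans_trans_assoc h₁ h₄, h', X.trans_trans_assoc]
    · change Germ.mk (x n ≫ s n ≫ X.trans (hn n)) = _
      rw [reassoc_of% (hxs n), trans_trans, ← Category.comp_id (trans _ _), Germ.mk_trans]
  exact ⟨asIso φ, fun n => rfl⟩

/-- Representatives of the two differentials of a `ℤ/2`-graded complex of projective systems, with
values in a common term of the systems and defined on a common later term. -/
structure DifferentialStage {A B : Pro E} (f : A ⟶ B) (g : B ⟶ A) where
  /-- The index of the target. -/
  lo : ℕ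
  /-- The index of the source. -/
  hi : ℕ
  le : lo ≤ hi
  /-- The representative of `f`. -/
  p : A.obj hi ⟶ B.obj lo
  /-- The representative of `g`. -/
  q : B.obj hi ⟶ A.obj lo
  mk_p : Pro.Germ.mk p = Pro.Hom.app f lo
  mk_q : Pro.Germ.mk q = Pro.Hom.app g lo

section

variable {A B : Pro E} {f : A ⟶ B} {g : B ⟶ A}

theorem exists_differentialStage (f : A ⟶ B) (g : B ⟶ A) : Nonempty (DifferentialStage f g) := by
  obtain ⟨m, p, hp⟩ := (Pro.Hom.app f 0).exists_rep
  obtain ⟨m', q, hq⟩ := (Pro.Hom.app g 0).exists_rep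
  exact ⟨⟨0, max m m', Nat.zero_le _, A.trans (le_max_left _ _) ≫ p,
    B.trans (le_max_right _ _) ≫ q, by rw [Pro.Germ.mk_trans, hp],
    by rw [Pro.Germ.mk_trans, hq]⟩⟩

variable [Preadditive E]

/-- All sufficiently late representatives of `f` are compatible with a given earlier representative
`p`, and compose to zero with `q` if `q` represents a germ whose precomposition with `f` is zero. -/
theorem exists_representative_after {A' B' : Pro E} (f : A' ⟶ B') {n m m' : ℕ} (h : n ≤ m)
    (p : A'.obj m' ⟶ B'.obj n) (hp : Pro.Germ.mk p = Pro.Hom.app f n) {T : E}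
    (q : B'.obj m ⟶ T) (hq : (Pro.Germ.mk q).pre f = 0) :
    ∃ M, ∀ N, M ≤ N → ∃ p' : A'.obj N ⟶ B'.obj m, Pro.Germ.mk p' = Pro.Hom.app f m ∧
      p' ≫ q = 0 ∧ ∀ h' : m' ≤ N, A'.trans h' ≫ p = p' ≫ B'.trans h := by
  obtain ⟨k, r, hr⟩ := (Pro.Hom.app f m).exists_rep
  rw [Pro.Germ.mk_pre, ← hr, Pro.Germ.mk_post] at hq
  have e : Pro.Germ.mk p = Pro.Germ.mk (r ≫ B'.trans h) := by
    rw [hp, ← Pro.Germ.mk_post, hr]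
    exact (Pro.Hom.app_post f h).symm
  obtain ⟨M₁, h₁⟩ := Pro.Germ.eventually_zero hq
  obtain ⟨M₂, h₂⟩ := Pro.Germ.eventually_eq e
  refine ⟨max k (max M₁ M₂), fun N hN => ?_⟩
  have hk : k ≤ N := (le_max_left _ _).trans hN
  have hM₁ : M₁ ≤ N := (le_max_left _ _).trans ((le_max_right _ _).trans hN)
  have hM₂ : M₂ ≤ N := (le_max_right _ _).trans ((le_max_right _ _).trans hN)
  refine ⟨A'.trans hk ≫ r, by rw [Pro.Germ.mk_trans, hr], ?_, fun h' => ?_⟩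
  · rw [Category.assoc, h₁ N hM₁ hk]
  · rw [Category.assoc, h₂ N hM₂ h' hk]

/-- A pair of representatives continues to a pair defined on the next stage, strictly compatible
with the first one and composing to zero with it. -/
theorem DifferentialStage.exists_next (hfg : f ≫ g = 0) (hgf : g ≫ f = 0)
    (s : DifferentialStage f g) :
    ∃ (k : ℕ) (h : s.hi < k) (p : A.obj k ⟶ B.obj s.hi) (q : B.obj k ⟶ A.obj s.hi),
      Pro.Germ.mk p = Pro.Hom.app f s.hi ∧ Pro.Germ.mk q = Pro.Hom.app g s.hi ∧
      p ≫ s.q = 0 ∧ q ≫ s.p = 0 ∧ A.trans h.le ≫ s.p = p ≫ B.trans s.le ∧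
      B.trans h.le ≫ s.q = q ≫ A.trans s.le := by
  obtain ⟨M₁, h₁⟩ := exists_representative_after f s.le s.p s.mk_p s.q (by
    rw [s.mk_q]
    exact congrFun (congrArg Pro.Hom.app hfg) s.lo)
  obtain ⟨M₂, h₂⟩ := exists_representative_after g s.le s.q s.mk_q s.p (by
    rw [s.mk_p]
    exact congrFun (congrArg Pro.Hom.app hgf) s.lo)
  let k := max (s.hi + 1) (max M₁ M₂)
  have hk : s.hi < k := Nat.lt_of_succ_le (le_max_left _ _)
  obtain ⟨p, hp, hp₁, hp₂⟩ := h₁ k ((le_max_left _ _).trans (le_max_right _ _))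
  obtain ⟨q, hq, hq₁, hq₂⟩ := h₂ k ((le_max_right _ _).trans (le_max_right _ _))
  exact ⟨k, hk, p, q, hp, hq, hp₁, hq₁, hp₂ _, hq₂ _⟩

/-- Two morphisms of projective systems composing to zero both ways are represented by maps between
subsystems that are strictly compatible with the structure maps and strictly compose to zero. -/
theorem exists_strict_representatives (hfg : f ≫ g = 0) (hgf : g ≫ f = 0) :
    ∃ (m : ℕ → ℕ) (hm : ∀ n, m n ≤ m (n + 1)) (p : ∀ n, A.obj (m (n + 1)) ⟶ B.obj (m n))
      (q : ∀ n, B.obj (m (n + 1)) ⟶ A.obj (m n)), (∀ n, n ≤ m n) ∧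
      (∀ n, Pro.Germ.mk (p n) = Pro.Hom.app f (m n)) ∧
      (∀ n, Pro.Germ.mk (q n) = Pro.Hom.app g (m n)) ∧
      (∀ n, p (n + 1) ≫ q n = 0) ∧ (∀ n, q (n + 1) ≫ p n = 0) ∧
      (∀ n, A.trans (hm (n + 1)) ≫ p n = p (n + 1) ≫ B.trans (hm n)) ∧
      ∀ n, B.trans (hm (n + 1)) ≫ q n = q (n + 1) ≫ A.trans (hm n) := by
  choose k hk p q hp hq hpq hqp hp' hq' using DifferentialStage.exists_next hfg hgf
  let s₀ : DifferentialStage f g := ⟨_, _, (hk (exists_differentialStage f g).some).le,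
    p _, q _, hp _, hq _⟩
  let next (s : DifferentialStage f g) : DifferentialStage f g :=
    ⟨s.hi, k s, (hk s).le, p s, q s, hp s, hq s⟩
  let st (n : ℕ) : DifferentialStage f g := Nat.rec s₀ (fun _ s => next s) n
  have hlt (n : ℕ) : (st n).lo < (st (n + 1)).lo := by
    cases n with
    | zero => exact hk _
    | succ n => exact hk _
  exact ⟨fun n => (st n).lo, fun n => (st n).le, fun n => (st n).p, fun n => (st n).q,
    fun n => (strictMono_nat_of_lt_succ hlt).le_apply, fun n => (st n).mk_p, fun n => (st n).mk_q,
    fun n => hpq (st n), fun n => hqp (st n), fun n => hp' (st n), fun n => hq' (st n)⟩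

end

end Straighten

section Pair

variable {E : Type w₁} [Category.{w₂} E] [Preadditive E]

/-- The `ℤ/2`-graded complex with `P` in degree `0` and `Q` in degree `1`, the degrees
being elements of `ZMod 2`, which is `Fin 2` by definition. -/
def komOfPair {P Q : E} (f : P ⟶ Q) (g : Q ⟶ P) (hfg : f ≫ g = 0) (hgf : g ≫ f = 0) : Kom E where
  X := fun (i : Fin 2) => match i with
    | 0 => P
    | 1 => Q
  d := fun (i j : Fin 2) => match i, j with
    | 0, 1 => f
    | 1, 0 => g
    | 0, 0 => 0
    | 1, 1 => 0
  shape := fun (i j : Fin 2) h => match i, j, h with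
    | 0, 1, h => (h rfl).elim
    | 1, 0, h => (h rfl).elim
    | 0, 0, _ => rfl
    | 1, 1, _ => rfl
  d_comp_d' := fun (i j k : Fin 2) h h' => match i, j, k, h, h' with
    | 0, 1, 0, _, _ => hfg
    | 1, 0, 1, _, _ => hgf
    | 0, 0, _, h, _ => absurd (show (0 : Fin 2) + 1 = 0 from h) (by decide)
    | 1, 1, _, h, _ => absurd (show (1 : Fin 2) + 1 = 1 from h) (by decide)
    | _, 0, 0, _, h => absurd (show (0 : Fin 2) + 1 = 0 from h) (by decide)
    | _, 1, 1, _, h => absurd (show (1 : Fin 2) + 1 = 1 from h) (by decide)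

/-- The chain map between such complexes given by its components in degrees `0` and `1`. -/
def komOfPairMap {P Q P' Q' : E} {f : P ⟶ Q} {g : Q ⟶ P} {hfg : f ≫ g = 0} {hgf : g ≫ f = 0}
    {f' : P' ⟶ Q'} {g' : Q' ⟶ P'} {hfg' : f' ≫ g' = 0} {hgf' : g' ≫ f' = 0}
    (a : P ⟶ P') (b : Q ⟶ Q') (h₁ : a ≫ f' = f ≫ b) (h₂ : b ≫ g' = g ≫ a) :
    komOfPair f g hfg hgf ⟶ komOfPair f' g' hfg' hgf' where
  f := fun (i : Fin 2) => match i with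
    | 0 => a
    | 1 => b
  comm' := fun (i j : Fin 2) h => match i, j, h with
    | 0, 1, _ => h₁
    | 1, 0, _ => h₂
    | 0, 0, h => absurd (show (0 : Fin 2) + 1 = 0 from h) (by decide)
    | 1, 1, h => absurd (show (1 : Fin 2) + 1 = 1 from h) (by decide)

/-- Gluing `A₀` to `B₁` along `A₁`: the universal object `B` under `B₁` and `A₀` in which the two
maps out of `A₁` agree and `B₁ ⟶ A₀ ⟶ B` vanishes. -/
theorem exists_glue [HasFiniteColimits E] {A₁ A₀ B₁ : E} (f : A₁ ⟶ B₁) (t : A₁ ⟶ A₀)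
    (g : B₁ ⟶ A₀) :
    ∃ (B : E) (u : B₁ ⟶ B) (v : A₀ ⟶ B), f ≫ u = t ≫ v ∧ g ≫ v = 0 ∧
      (∀ {T : E} (x : B₁ ⟶ T) (y : A₀ ⟶ T), f ≫ x = t ≫ y → g ≫ y = 0 →
        ∃ s, u ≫ s = x ∧ v ≫ s = y) ∧
      ∀ {T : E} {s s' : B ⟶ T}, u ≫ s = u ≫ s' → v ≫ s = v ≫ s' → s = s' := by
  refine ⟨pushout f (t ≫ cokernel.π g), pushout.inl _ _, cokernel.π g ≫ pushout.inr _ _, ?_, ?_,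
    fun {T} x y h h' => ⟨pushout.desc x (cokernel.desc g y h') (by simpa using h),
      pushout.inl_desc _ _ _, by rw [Category.assoc, pushout.inr_desc, cokernel.π_desc]⟩,
    fun {T s s'} h h' => ?_⟩
  · rw [pushout.condition, Category.assoc]
  · rw [cokernel.condition_assoc, zero_comp]
  · refine pushout.hom_ext h ?_
    rwa [Category.assoc, Category.assoc, cancel_epi] at h'

/-- Two morphisms of projective systems composing to zero both ways are represented by maps
`A (a n) ⟶ B (b n)` and `B (b (n + 1)) ⟶ A (a n)` that are strictly compatible with the structure
maps and strictly compose to zero. -/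
theorem exists_staircase {A B : Pro E} {f : A ⟶ B} {g : B ⟶ A} (hfg : f ≫ g = 0)
    (hgf : g ≫ f = 0) :
    ∃ (a b : ℕ → ℕ) (ha : ∀ n, a n ≤ a (n + 1)) (hb : ∀ n, b n ≤ b (n + 1))
      (p : ∀ n, A.obj (a n) ⟶ B.obj (b n)) (q : ∀ n, B.obj (b (n + 1)) ⟶ A.obj (a n)),
      (∀ n, n ≤ a n) ∧ (∀ n, n ≤ b n) ∧ (∀ n, Pro.Germ.mk (p n) = Pro.Hom.app f (b n)) ∧
      (∀ n, Pro.Germ.mk (q n) = Pro.Hom.app g (a n)) ∧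
      (∀ n, p (n + 1) ≫ q n = 0) ∧ (∀ n, q n ≫ p n = 0) ∧
      (∀ n, A.trans (ha n) ≫ p n = p (n + 1) ≫ B.trans (hb n)) ∧
      ∀ n, B.trans (hb (n + 1)) ≫ q n = q (n + 1) ≫ A.trans (ha n) := by
  obtain ⟨m, hm, p, q, hnm, hp, hq, hpq, hqp, hp', hq'⟩ := exists_strict_representatives hfg hgf
  refine ⟨fun n => m (2 * n + 1), fun n => m (2 * n), fun n => (hm _).trans (hm _),
    fun n => (hm _).trans (hm _), fun n => p (2 * n), fun n => q (2 * n + 1),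
    fun n => le_trans (by lia) (hnm _), fun n => le_trans (by lia) (hnm _), fun n => hp _,
    fun n => hq _, fun n => hpq (2 * n + 1), fun n => hqp (2 * n), fun n => ?_, fun n => ?_⟩
  · rw [← A.trans_trans (hm (2 * n + 1)) (hm (2 * n + 2)), Category.assoc, hp', ← Category.assoc,
      hp', Category.assoc, Pro.trans_trans]
    rfl
  · change B.trans ((hm (2 * n + 2)).trans (hm (2 * n + 3))) ≫ _ = _
    rw [← B.trans_trans (hm (2 * n + 2)) (hm (2 * n + 3)), Category.assoc, hq', ← Category.assoc,
      hq', Category.assoc, Pro.trans_trans]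
    rfl

/-- A pair of morphisms of projective systems composing to zero both ways is a projective system of
complexes, up to isomorphism. In the representation by `exists_staircase` every level has a
differential from degree `1` to degree `0`, but the other one starts at a later level than it ends.
So the term `A (a n)` in degree `0` is kept and `B (b (n + 1))` is replaced in degree `1` by its
gluing with `A (a n)`, which makes room for a differential out of `A (a n)`. -/
theorem exists_tower_of_pair [HasFiniteColimits E] {A B : Pro E} {f : A ⟶ B} {g : B ⟶ A}
    (hfg : f ≫ g = 0) (hgf : g ≫ f = 0) :
    ∃ (L : ℕᵒᵖ ⥤ Kom E) (φ : A ≅ (komOfTower L).X 0) (ψ : B ≅ (komOfTower L).X 1),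
      φ.hom ≫ (komOfTower L).d 0 1 = f ≫ ψ.hom ∧ ψ.hom ≫ (komOfTower L).d 1 0 = g ≫ φ.hom := by
  obtain ⟨a, b, ha, hb, p, q, hna, hnb, hp, hq, hpq, hqp, hp', hq'⟩ := exists_staircase hfg hgf
  choose B' u v huv hv desc hom_ext using fun n => exists_glue (p (n + 1)) (A.trans (ha n)) (q n)
  choose out hout_u hout_v using fun n => desc n (B.trans (hb n)) (p n) (hp' n).symm (hqp n)
  choose q' hq'_u hq'_v using fun n => desc n (q n) 0 (by rw [hpq, comp_zero]) comp_zero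
  have hq'v (n : ℕ) : q' n ≫ v n = 0 := by
    apply hom_ext
    · rw [reassoc_of% (hq'_u n), hv, comp_zero]
    · rw [reassoc_of% (hq'_v n), zero_comp, comp_zero]
  let K (n : ℕ) : Kom E := komOfPair (v n) (q' n) (hq'_v n) (hq'v n)
  let step (n : ℕ) : K (n + 1) ⟶ K n := komOfPairMap (A.trans (ha n)) (out (n + 1) ≫ u n)
    (by rw [reassoc_of% (hout_v (n + 1)), huv]) (by
      rw [Category.assoc, hq'_u]
      apply hom_ext
      · rw [reassoc_of% (hout_u (n + 1)), reassoc_of% (hq'_u (n + 1)), hq']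
      · rw [reassoc_of% (hout_v (n + 1)), reassoc_of% (hq'_v (n + 1)), hpq, zero_comp])
  let L : ℕᵒᵖ ⥤ Kom E := Functor.ofOpSequence step
  have hL (n : ℕ) : L.map (homOfLE n.le_succ).op = step n :=
    Functor.ofOpSequence_map_homOfLE_succ step n
  have hL₀ (n : ℕ) : ((komOfTower L).X 0).trans n.le_succ = A.trans (ha n) :=
    congrArg (fun φ => HomologicalComplex.Hom.f φ 0) (hL n)
  have hL₁ (n : ℕ) : ((komOfTower L).X 1).trans n.le_succ = out (n + 1) ≫ u n :=
    congrArg (fun φ => HomologicalComplex.Hom.f φ 1) (hL n)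
  obtain ⟨φ, hφ⟩ := Pro.exists_iso_of_interleaving (X := A) (Y := (komOfTower L).X 0) a a hna
    (fun n => le_rfl) ha (fun n => 𝟙 (A.obj (a n))) (fun n => 𝟙 (A.obj (a n)))
    (fun n => by rw [Pro.trans_self]; exact Category.comp_id _) (fun n => by
      rw [hL₀]
      exact (Category.id_comp _).trans (Category.comp_id _))
  obtain ⟨ψ, hψ⟩ := Pro.exists_iso_of_interleaving (X := B) (Y := (komOfTower L).X 1)
    (fun n => b (n + 1)) b hnb hb (fun n => le_rfl) u out hout_u (fun n => by
      rw [hL₁, Pro.trans_self]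
      exact congrArg _ (Category.id_comp _))
  refine ⟨L, φ, ψ, Pro.hom_ext fun n => ?_, Pro.hom_ext fun n => ?_⟩
  · change (Pro.Hom.app φ.hom n).post (v n) = (Pro.Hom.app ψ.hom n).pre f
    rw [hφ, hψ]
    change Pro.Germ.mk (𝟙 _ ≫ v n) = (Pro.Hom.app f (b (n + 1))).post (u n)
    rw [← hp, Pro.Germ.mk_post, huv, Pro.Germ.mk_trans, Category.id_comp]
  · change (Pro.Hom.app ψ.hom n).post (q' n) = (Pro.Hom.app φ.hom n).pre g
    rw [hφ, hψ]
    change Pro.Germ.mk (u n ≫ q' n) = (Pro.Hom.app g (a n)).post (𝟙 _)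
    rw [← hq, Pro.Germ.post_id, hq'_u]

/-- Every `ℤ/2`-graded complex of projective systems is isomorphic to a projective system of
complexes. -/
theorem exists_iso_komOfTower [HasFiniteColimits E] (X : Kom (Pro E)) :
    ∃ L : ℕᵒᵖ ⥤ Kom E, Nonempty (X ≅ komOfTower L) := by
  obtain ⟨L, φ, ψ, h, h'⟩ := exists_tower_of_pair (X.d_comp_d 0 1 0) (X.d_comp_d 1 0 1)
  exact ⟨L, ⟨HomologicalComplex.Hom.isoOfComponents
    (fun (i : Fin 2) => match i with
      | 0 => φ
      | 1 => ψ)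
    (fun (i j : Fin 2) r => match i, j, r with
      | 0, 1, _ => h
      | 1, 0, _ => h'
      | 0, 0, r => absurd (show (0 : Fin 2) + 1 = 0 from r) (by decide)
      | 1, 1, r => absurd (show (1 : Fin 2) + 1 = 1 from r) (by decide))⟩⟩

end Pair

section Presentations

variable {C : Type u} [Category.{v} C] [Preadditive C] [HasFiniteBiproducts C]

theorem nonempty_presentation [HasFiniteColimits C] (X : Kom (Pro (Ind C))) :
    Nonempty (Presentation X) := by
  obtain ⟨L, ⟨φ⟩⟩ := exists_iso_komOfTower X
  choose J hJ hJ' K α hα using fun k => exists_kom_presentation (L.obj (op k))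
  exact ⟨⟨L, φ, J, K, α, hα⟩⟩

end Presentations

end ProInd

theorem mainTheorem6 {C : Type u} [Category.{v} C] [Preadditive C] [HasFiniteBiproducts C]
    [HasKernels C] [HasCokernels C] (X : ProInd.Kom (ProInd.Pro (Ind C))) :
    Nonempty (ProInd.Presentation X) ∧
      ∀ P : ProInd.Presentation X,
        P.IsLocallyContractible ↔ ProInd.IsExactComplex ProInd.IsLocallySplit X := by
  have : HasEqualizers C := Preadditive.hasEqualizers_of_hasKernels
  have : HasCoequalizers C := Preadditive.hasCoequalizers_of_hasCokernels
  have : HasFiniteLimits C := hasFiniteLimits_of_hasEqualizers_and_finite_products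
  have : HasFiniteColimits C := hasFiniteColimits_of_hasCoequalizers_and_finite_coproducts
  exact ⟨ProInd.nonempty_presentation X,
    fun P => ProInd.isLocallyContractible_iff_isExactComplex P⟩
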